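/- Let $k\ge 1$. Let $\mathrm{FIN}_{\pm k}$ be the set of functions $p:\omega\to\{0,\pm1,\dots,\pm k\}$ whose support $\operatorname{supp}p=\{n:p(n)\ne0\}$ is finite and which attain at least one of the values $k,-k$; it carries the discrete topology. Write $p<q$ if $\max\operatorname{supp}p<\min\operatorname{supp}q$, and let $\mathrm{FIN}_{\pm k}^{[\infty]}$ be the set of infinite block sequences $B=(b_i)_{i<\omega}$ in $\mathrm{FIN}_{\pm k}$, i.e. $b_i<b_j$ whenever $i<j$. The tetris operation $T$ is given by $T(p)(n)=p(n)-1$ if $p(n)>0$, $T(p)(n)=0$ if $p(n)=0$, and $T(p)(n)=p(n)+1$ if $p(n)<0$. For $B=(b_i)_{i<\omega}\in\mathrm{FIN}_{\pm k}^{[\infty]}$ let $$[B]_{\pm k}=\{\varepsilon_0T^{j_0}(b_{n_0})+\dots+\varepsilon_mT^{j_m}(b_{n_m}) : m<\omega,\ n_0<\dots<n_m,\ \varepsilon_i\in\{\pm1\},\ 0\le j_i<k,\ \min_i j_i=0\}.$$ A subset of a topological space is Souslin measurable if it belongs to the smallest field of subsets that contains all open sets and is closed under the Souslin operation $(X_s)_{s\in\omega^{<\omega}}\mapsto\bigcup_{x\in\omega^\omega}\bigcap_{n<\omega}X_{x\restriction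 n}$. A map to a finite set is Souslin measurable if all its fibres are. Let $2^\omega$ be the Cantor space, let $n<\omega$, and let $c:\mathrm{FIN}_{\pm k}\times(2^\omega)^\omega\to\{0,\dots,n-1\}$ be a Souslin measurable colouring, where $\mathrm{FIN}_{\pm k}\times(2^\omega)^\omega$ has the product topology. Then there are $B\in\mathrm{FIN}_{\pm k}^{[\infty]}$, a sequence $(P_i)_{i<\omega}$ of non-empty perfect subsets of $2^\omega$, and a colour $j<n$ such that for every $b\in[B]_{\pm k}$ and every $(p_i)_{i<\omega}\in\prod_{i<\omega}P_i$ there is $\tilde b\in\mathrm{FIN}_{\pm k}$ with $$c(\tilde b,(p_i)_{i<\omega})=j\quad\text{and}\quad\|b-\tilde b\|_\infty\le1.$$ -/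

import Mathlib

/-- The restriction `x ↾ n = (x 0, …, x (n - 1))` of an infinite sequence of natural numbers. -/
def seqRestrict (x : ℕ → ℕ) (n : ℕ) : List ℕ :=
  List.ofFn fun i : Fin n => x i

/-- The Souslin operation applied to a Souslin scheme `(X_s)`, indexed by the finite sequences
of natural numbers. -/
def souslinOperation {α : Type*} (X : List ℕ → Set α) : Set α :=
  ⋃ x : ℕ → ℕ, ⋂ n : ℕ, X (seqRestrict x n)

/-- The members of the smallest field of subsets of `α` that contains all open sets and is closed
under the Souslin operation. -/
inductive SouslinMeasurable {α : Type*} [TopologicalSpace α] : Set α → Prop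
  | of_isOpen (U : Set α) (hU : IsOpen U) : SouslinMeasurable U
  | compl (A : Set α) (hA : SouslinMeasurable A) : SouslinMeasurable Aᶜ
  | union (A B : Set α) (hA : SouslinMeasurable A) (hB : SouslinMeasurable B) :
      SouslinMeasurable (A ∪ B)
  | souslin (X : List ℕ → Set α) (hX : ∀ s, SouslinMeasurable (X s)) :
      SouslinMeasurable (souslinOperation X)

/-- `FIN_{±k}`: the finitely supported `p : ℕ → {0, ±1, …, ±k}` that take at least one of the
values `k`, `-k`. -/
structure FinPM (k : ℕ) where
  /-- The underlying finitely supported integer-valued function. -/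
  toFinsupp : ℕ →₀ ℤ
  abs_le : ∀ n, |toFinsupp n| ≤ (k : ℤ)
  exists_abs_eq : ∃ n, |toFinsupp n| = (k : ℤ)

/-- The countable set `FIN_{±k}` carries the discrete topology. -/
instance FinPM.instTopologicalSpace (k : ℕ) : TopologicalSpace (FinPM k) := ⊥

instance FinPM.instDiscreteTopology (k : ℕ) : DiscreteTopology (FinPM k) := ⟨rfl⟩

/-- `p < q` for elements of `FIN_{±k}`: `max (supp p) < min (supp q)`. -/
def FinPM.Before {k : ℕ} (p q : FinPM k) : Prop :=
  ∀ m ∈ p.toFinsupp.support, ∀ n ∈ q.toFinsupp.support, m < n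

/-- One step of the tetris operation on a single value: move it by one towards `0`. -/
def tetrisValue (z : ℤ) : ℤ :=
  if 0 < z then z - 1 else if z < 0 then z + 1 else 0

/-- The tetris operation `T`, on all finitely supported integer-valued functions. It maps
`FIN_{±k}` to `FIN_{±(k-1)}` for `k ≥ 1`. -/
noncomputable def tetris (p : ℕ →₀ ℤ) : ℕ →₀ ℤ :=
  p.mapRange tetrisValue (by simp [tetrisValue])

/-- `FIN_{±k}^{[∞]}`: the infinite block sequences in `FIN_{±k}`. -/
structure BlockSeq (k : ℕ) where
  /-- The terms of the sequence. -/
  term : ℕ → FinPM k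
  before : ∀ n m, n < m → (term n).Before (term m)

/-- `[B]_{±k}`: the elements of `FIN_{±k}` of the form
`ε₀ T^{j₀}(b_{n₀}) + ⋯ + ε_m T^{j_m}(b_{n_m})` with `n₀ < ⋯ < n_m`, all `ε_i = ±1`,
all `j_i < k`, and `min j_i = 0`. -/
def BlockSeq.generated {k : ℕ} (B : BlockSeq k) : Set (FinPM k) :=
  {b | ∃ (m : ℕ) (ν : Fin (m + 1) → ℕ) (ε : Fin (m + 1) → ℤ) (j : Fin (m + 1) → ℕ),
    StrictMono ν ∧ (∀ i, ε i = 1 ∨ ε i = -1) ∧ (∀ i, j i < k) ∧ (∃ i, j i = 0) ∧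
    b.toFinsupp = ∑ i, ε i • tetris^[j i] (B.term (ν i)).toFinsupp}

/-- The `ℓ_∞` norm of a finitely supported integer-valued function (a natural number). -/
def supNorm (p : ℕ →₀ ℤ) : ℕ :=
  p.support.sup fun n => (p n).natAbs

/-! For one parameter p, the colours are stabilised by ultrafilters with `Ξ i + Ξ j = Ξ (min i j)`,
as in Gowers' theorem: once a colour class lies in `Ξ 0`, blocks can be added forever, choosing for
the letter `ε T^j` a sequence from a `Ξ j`-large set, and every sum that uses a letter with j = 0
stays in the class. The error 1 enters because the chosen sequence need only be near `ε T^j b`.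

A common b must serve all letters and many p at once, and quantifying over an ultrafilter may
destroy the Baire property. Hence the definable filters `towerFilter m` of generic sums of hills of
height m. Their quantifiers arise from "for all large n" by iteration and by least and greatest
fixed points, so they preserve the Baire property (`preservesBaire_towerFilter`). T carries level m
+ 1 to level m, and negation preserves each level. The link is `Shadows`: a generic b is near a
member of any given large set, and `Ξ j` shadows level k - j.

The chain (`exists_towerChain`) grows by two heights at a time. Hills of neighbouring heights are
near, so one idempotent that absorbs hills of height l shadows both level l and level l + 1.
Absorption comes from a minimal left ideal of a compact semigroup. The filters use pairs of hills of
opposite signs so that a single hill of either sign, surrounded by an absorbing idempotent, already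
shadows them: the missing partner is hidden in the idempotent.

As p varies, the set of p for which a finite state is good may lack the Baire property. It is
replaced by its open hull (`exists_open_hull`). Extendability along `towerFilter k` has the Baire
property and holds on the good set, hence generically on the hull (`exists_open_state_system`). A
fusion (`exists_fusion`) over finite trees in every coordinate then yields the perfect sets and the
blocks: finitely many filter conditions have a common b, and openness spreads each choice from a
generic point to a box. -/

open Filter Topology Set

/-! ### The Baire property, fixed points and open hulls -/

section BaireProperty

variable {X : Type*} [TopologicalSpace X]

theorem eventually_residual_biUnion_basis {p : Set X → Prop} [SecondCountableTopology X] {Q : X → Prop}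
    (h : ∀ U ∈ TopologicalSpace.countableBasis X, p U → ∀ᶠ x in residual X, x ∈ U → Q x) :
    ∀ᶠ x in residual X, ∀ U ∈ TopologicalSpace.countableBasis X, p U → x ∈ U → Q x := by
  rw [eventually_countable_ball (TopologicalSpace.countable_countableBasis X)]
  intro U hU
  by_cases hp : p U
  · filter_upwards [h U hU hp] with x hx _ using hx
  · exact Eventually.of_forall fun x hp' => (hp hp').elim

/-- An open set is determined modulo meagre sets by the basic open sets it contains. -/
theorem eventually_residual_of_isOpen [SecondCountableTopology X] {G : Set X} (hG : IsOpen G)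
    {Q : X → Prop}
    (h : ∀ U ∈ TopologicalSpace.countableBasis X, U ⊆ G → ∀ᶠ x in residual X, x ∈ U → Q x) :
    ∀ᶠ x in residual X, x ∈ G → Q x := by
  filter_upwards [eventually_residual_biUnion_basis h] with x hx hxG
  obtain ⟨U, hU, hxU, hUG⟩ :=
    (TopologicalSpace.isBasis_countableBasis X).exists_subset_of_mem_open hxG hG
  exact hx U hU hUG hxU

/-- Pointwise least fixed points of operators that preserve countable families of sets with the
Baire property have the Baire property. -/
theorem BaireMeasurableSet.lfp [SecondCountableTopology X] {ι : Type*} [Countable ι]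
    (φ : X → Set ι →o Set ι)
    (hφ : ∀ V : ι → Set X, (∀ i, BaireMeasurableSet (V i)) →
      ∀ i, BaireMeasurableSet {p | i ∈ φ p {j | p ∈ V j}}) (i : ι) :
    BaireMeasurableSet {p | i ∈ OrderHom.lfp (φ p)} := by
  classical
  -- Instead of a transfinite iteration: among the families with the Baire property below the fixed
  -- point, pick for each basic open set and index one that is comeagre there, if there is any. The
  -- countable union of these picks is the fixed point modulo a meagre set.
  let 𝒱 : Set (ι → Set X) :=
    {V | (∀ i, BaireMeasurableSet (V i)) ∧ ∀ i, ∀ p ∈ V i, i ∈ OrderHom.lfp (φ p)}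
  have h0 : (fun _ => ∅ : ι → Set X) ∈ 𝒱 := by
    refine ⟨fun i => isOpen_empty.baireMeasurableSet, by simp⟩
  have hch : ∀ (U : TopologicalSpace.countableBasis X) (i : ι), ∃ V ∈ 𝒱,
      (∃ V' ∈ 𝒱, ∀ᶠ p in residual X, p ∈ (U : Set X) → p ∈ V' i) →
        ∀ᶠ p in residual X, p ∈ (U : Set X) → p ∈ V i := by
    intro U i
    by_cases h : ∃ V' ∈ 𝒱, ∀ᶠ p in residual X, p ∈ (U : Set X) → p ∈ V' i
    · obtain ⟨V', hV', h'⟩ := h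
      exact ⟨V', hV', fun _ => h'⟩
    · exact ⟨_, h0, fun h' => (h h').elim⟩
  choose V hV hVU using hch
  have : Countable (TopologicalSpace.countableBasis X) :=
    (TopologicalSpace.countable_countableBasis X).to_subtype
  let V₁ : ι → Set X := fun i => ⋃ (U) (k), V U k i
  have hV₁ : V₁ ∈ 𝒱 := by
    refine ⟨fun i => .iUnion fun U => .iUnion fun k => (hV U k).1 i, fun i p hp => ?_⟩
    simp only [V₁, mem_iUnion] at hp
    obtain ⟨U, k, hp⟩ := hp
    exact (hV U k).2 i p hp
  let V₂ : ι → Set X := fun i => {p | i ∈ φ p {j | p ∈ V₁ j}}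
  have hV₂ : V₂ ∈ 𝒱 := by
    refine ⟨hφ V₁ hV₁.1, fun i p hp => ?_⟩
    rw [← OrderHom.map_lfp]
    exact (φ p).monotone (fun j hj => hV₁.2 j p hj) hp
  -- If `V₂ i \ V₁ i` were nonmeagre, it would be comeagre in some basic U; then `V₂` shows that the
  -- pick for `(U, i)` is comeagre in U, and `V₁` contains that pick.
  have hclosed : ∀ i, ∀ᶠ p in residual X, p ∈ V₂ i → p ∈ V₁ i := by
    intro i
    obtain ⟨G, hG, hGV⟩ := ((hV₂.1 i).diff (hV₁.1 i)).residualEq_isOpen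
    have hGV' := hGV.mem_iff
    have : ∀ᶠ p in residual X, p ∈ G → False := by
      refine eventually_residual_of_isOpen hG fun U hU hUG => ?_
      have := hVU ⟨U, hU⟩ i ⟨V₂, hV₂, by
        filter_upwards [hGV'] with p hp hpU using (hp.2 (hUG hpU)).1⟩
      filter_upwards [hGV', this] with p hp hp' hpU
      exact (hp.2 (hUG hpU)).2 (mem_iUnion₂.2 ⟨⟨U, hU⟩, i, hp' hpU⟩)
    filter_upwards [hGV', this] with p hp hp' h2
    by_contra h1
    exact hp' (hp.1 ⟨h2, h1⟩)
  refine (hV₁.1 i).congr ?_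
  have hall := eventually_countable_forall.2 hclosed
  filter_upwards [hall] with p hp
  refine propext ⟨fun h => hV₁.2 i p h, fun h => ?_⟩
  exact OrderHom.lfp_le (φ p) (a := {j | p ∈ V₁ j}) (fun j hj => hp j hj) h

theorem BaireMeasurableSet.gfp [SecondCountableTopology X] {ι : Type*} [Countable ι]
    (φ : X → Set ι →o Set ι)
    (hφ : ∀ V : ι → Set X, (∀ i, BaireMeasurableSet (V i)) →
      ∀ i, BaireMeasurableSet {p | i ∈ φ p {j | p ∈ V j}}) (i : ι) :
    BaireMeasurableSet {p | i ∈ OrderHom.gfp (φ p)} := by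
  let ψ : X → Set ι →o Set ι := fun p =>
    ⟨fun Z => (φ p Zᶜ)ᶜ, fun Z Z' h => compl_subset_compl.2
      ((φ p).monotone (compl_subset_compl.2 h))⟩
  have key : ∀ p, OrderHom.gfp (φ p) = (OrderHom.lfp (ψ p))ᶜ := by
    intro p
    apply le_antisymm
    · rw [← compl_le_compl_iff_le, compl_compl]
      apply OrderHom.lfp_le
      change (φ p (OrderHom.gfp (φ p))ᶜᶜ)ᶜ ≤ _
      rw [compl_compl, OrderHom.map_gfp]
    · apply OrderHom.le_gfp
      rw [← compl_le_compl_iff_le, compl_compl]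
      exact (OrderHom.map_lfp (ψ p)).le
  have := BaireMeasurableSet.lfp ψ (fun V hV i => (hφ (fun j => (V j)ᶜ)
    (fun j => (hV j).compl) i).compl) i
  simp only [key]
  exact this.compl

theorem seqRestrict_succ (x : ℕ → ℕ) (n : ℕ) :
    seqRestrict x (n + 1) = seqRestrict x n ++ [x n] := by
  rw [seqRestrict, List.ofFn_succ_last]
  simp [seqRestrict]

theorem exists_seqRestrict_eq_of_tree {Q : List ℕ → Prop} (h0 : Q [])
    (h : ∀ s, Q s → ∃ n, Q (s ++ [n])) : ∃ x : ℕ → ℕ, ∀ n, Q (seqRestrict x n) := by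
  choose! f hf using h
  let y : ℕ → List ℕ := fun n => Nat.rec [] (fun _ s => s ++ [f s]) n
  have hy : ∀ n, y n = seqRestrict (fun m => f (y m)) n := by
    intro n
    induction n with
    | zero => simp [y, seqRestrict]
    | succ n ih => rw [seqRestrict_succ, ← ih]
  refine ⟨fun m => f (y m), fun n => ?_⟩
  rw [← hy]
  induction n with
  | zero => exact h0
  | succ n ih => exact hf _ ih

/-- A point is outside the Souslin set exactly when its tree of surviving finite sequences is
well-founded, that is, when the root lies in a least fixed point. -/
theorem BaireMeasurableSet.souslinOperation [SecondCountableTopology X] {S : List ℕ → Set X}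
    (hS : ∀ s, BaireMeasurableSet (S s)) : BaireMeasurableSet (souslinOperation S) := by
  let φ : X → Set (List ℕ) →o Set (List ℕ) := fun p =>
    ⟨fun Y => {s | p ∉ S s ∨ ∀ n, s ++ [n] ∈ Y}, fun Y Y' h s hs =>
      hs.imp id fun hs n => h (hs n)⟩
  have hφ := BaireMeasurableSet.lfp φ (fun V hV s => by
    have : {p | s ∈ φ p {j | p ∈ V j}} = (S s)ᶜ ∪ ⋂ n, V (s ++ [n]) := by
      ext p
      simp only [mem_union, mem_compl_iff, mem_iInter]
      rfl
    rw [this]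
    exact (hS s).compl.union (.iInter fun n => hV _)) []
  apply BaireMeasurableSet.of_compl
  convert hφ using 1
  ext p
  simp only [_root_.souslinOperation, mem_compl_iff, mem_iUnion, mem_iInter, mem_ofPred_eq]
  constructor
  · intro h
    by_contra h0
    apply h
    refine (exists_seqRestrict_eq_of_tree (Q := fun s => s ∉ OrderHom.lfp (φ p)) h0
      fun s hs => ?_).imp fun x hx n => ?_
    · rw [← OrderHom.map_lfp] at hs
      by_contra! hn
      exact hs (Or.inr hn)
    · by_contra hn
      apply hx n
      rw [← OrderHom.map_lfp]
      exact Or.inl hn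
  · rintro h ⟨x, hx⟩
    have : OrderHom.lfp (φ p) ≤ {s | ∀ n, s ≠ seqRestrict x n} := by
      apply OrderHom.lfp_le
      rintro s (hs | hs) n rfl
      · exact hs (hx n)
      · exact hs (x n) (n + 1) (seqRestrict_succ x n).symm
    exact this h 0 (by simp [seqRestrict])

theorem SouslinMeasurable.baireMeasurableSet_preimage [SecondCountableTopology X] {Y : Type*}
    [TopologicalSpace Y] {f : X → Y} (hf : Continuous f) {S : Set Y} (hS : SouslinMeasurable S) :
    BaireMeasurableSet (f ⁻¹' S) := by
  induction hS with
  | of_isOpen U hU => exact (hU.preimage hf).baireMeasurableSet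
  | compl A _ h => exact h.compl
  | union A B _ _ hA hB => exact hA.union hB
  | souslin S _ h =>
    have : f ⁻¹' _root_.souslinOperation S = _root_.souslinOperation fun s => f ⁻¹' S s := by
      simp [_root_.souslinOperation, preimage_iUnion, preimage_iInter]
    rw [this]
    exact .souslinOperation h

/-- Remove every basic open set in which E is meagre and take the interior of the rest. If some B
containing E modulo meagre missed a nonmeagre part of the hull, its complement would be comeagre in
a basic open V meeting the hull; E is meagre in V, so V was removed. -/
theorem exists_open_hull [SecondCountableTopology X] (E : Set X) :
    ∃ Z : Set X, IsOpen Z ∧ (∀ᶠ p in residual X, p ∈ E → p ∈ Z) ∧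
      ∀ B, BaireMeasurableSet B → (∀ᶠ p in residual X, p ∈ E → p ∈ B) →
        ∀ᶠ p in residual X, p ∈ Z → p ∈ B := by
  let 𝒰 : Set (Set X) :=
    {U | U ∈ TopologicalSpace.countableBasis X ∧ ∀ᶠ p in residual X, p ∈ U → p ∉ E}
  have hO : IsOpen (⋃₀ 𝒰) :=
    isOpen_sUnion fun U hU => TopologicalSpace.isOpen_of_mem_countableBasis hU.1
  -- The frontier of an open set is nowhere dense, so passing to the interior loses only a meagre
  -- set.
  have hC : ∀ᶠ p in residual X, p ∈ (⋃₀ 𝒰)ᶜ → p ∈ interior (⋃₀ 𝒰)ᶜ := by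
    have h := coborder_mem_residual hO.isLocallyClosed
    filter_upwards [h] with p hp hpc
    rw [interior_compl]
    intro hcl
    rw [coborder_eq_union_closure_compl] at hp
    exact hp.elim hpc fun h => h hcl
  refine ⟨interior (⋃₀ 𝒰)ᶜ, isOpen_interior, ?_, fun B hB hEB => ?_⟩
  · have := eventually_residual_biUnion_basis (X := X)
      (p := fun U => ∀ᶠ p in residual X, p ∈ U → p ∉ E) (Q := fun p => p ∉ E) fun U _ h => h
    filter_upwards [this, hC] with p hp hpC hpE
    refine hpC ?_
    rintro ⟨U, hU, hpU⟩
    exact hp U hU.1 hU.2 hpU hpE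
  · obtain ⟨G, hG, hGB⟩ := hB.compl.residualEq_isOpen
    filter_upwards [hGB.mem_iff] with p hp hpZ
    by_contra hpB
    obtain ⟨V, hV, hpV, hVG⟩ :=
      (TopologicalSpace.isBasis_countableBasis X).exists_subset_of_mem_open (hp.1 hpB) hG
    refine interior_subset hpZ ⟨V, ⟨hV, ?_⟩, hpV⟩
    filter_upwards [hGB.mem_iff, hEB] with q hq hq' hqV hqE
    exact hq.2 (hVG hqV) (hq' hqE)

end BaireProperty

/-! ### Filters of finitely supported sequences -/

section Shadows

/-- Finitely supported sequences of integers. -/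
abbrev FinSeq := ℕ →₀ ℤ

/-- Two sequences are near when they differ by at most one everywhere. -/
def Near (a b : FinSeq) : Prop := ∀ n, |a n - b n| ≤ 1

/-- All nonzero values are at places `≥ N`. -/
def SuppFrom (N : ℕ) (a : FinSeq) : Prop := ∀ n < N, a n = 0

/-- All nonzero values are at places `< N`. -/
def SuppBelow (N : ℕ) (a : FinSeq) : Prop := ∀ n, N ≤ n → a n = 0

/-- A filter is a tail filter when its generic elements are supported arbitrarily far out. -/
def IsTail (F : Filter FinSeq) : Prop := ∀ N, ∀ᶠ u in F, SuppFrom N u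

/-- The sum of filters, for the iterated quantifier. -/
noncomputable def sumFilter (F G : Filter FinSeq) : Filter FinSeq := F.bind fun u => G.map (u + ·)

infixl:65 " ⊹ " => sumFilter

/-- `Shadows x F`: generic elements of `F` are near elements of any given member of `x`. -/
def Shadows (x F : Filter FinSeq) : Prop := ∀ A ∈ x, ∀ᶠ b in F, ∃ a ∈ A, Near a b

variable {F F' G G' H x y e : Filter FinSeq} {a b u v : FinSeq} {N : ℕ} {D : Set FinSeq}

theorem exists_suppBelow (a : FinSeq) : ∃ N, SuppBelow N a := by
  obtain ⟨N, hN⟩ := a.support.exists_nat_subset_range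
  refine ⟨N, fun n hn => ?_⟩
  by_contra h
  have := hN (Finsupp.mem_support_iff.2 h)
  simp at this
  omega

theorem exists_suppBelow₂ (a b : FinSeq) : ∃ N, SuppBelow N a ∧ SuppBelow N b := by
  obtain ⟨N, hN⟩ := exists_suppBelow a
  obtain ⟨M, hM⟩ := exists_suppBelow b
  exact ⟨max N M, fun n hn => hN n (by omega), fun n hn => hM n (by omega)⟩

theorem SuppFrom.zero : SuppFrom N 0 := fun _ _ => rfl

theorem SuppFrom.mono {M : ℕ} (h : SuppFrom N a) (hM : M ≤ N) : SuppFrom M a :=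
  fun n hn => h n (by omega)

theorem SuppBelow.mono {M : ℕ} (h : SuppBelow N a) (hM : N ≤ M) : SuppBelow M a :=
  fun n hn => h n (by omega)

theorem SuppFrom.add (hu : SuppFrom N u) (hv : SuppFrom N v) : SuppFrom N (u + v) :=
  fun n hn => by simp [hu n hn, hv n hn]

theorem SuppBelow.add (hu : SuppBelow N u) (hv : SuppBelow N v) : SuppBelow N (u + v) :=
  fun n hn => by simp [hu n hn, hv n hn]

/-- Values of a sum of two separated sequences are values of one of them, uniformly. -/
theorem add_apply_eq_or {u' v' : FinSeq} (hu : SuppBelow N u) (hu' : SuppBelow N u')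
    (hv : SuppFrom N v) (hv' : SuppFrom N v') (n : ℕ) :
    ((u + v) n = u n ∧ (u' + v') n = u' n) ∨ ((u + v) n = v n ∧ (u' + v') n = v' n) := by
  rcases lt_or_ge n N with h | h
  · left; simp [hv n h, hv' n h]
  · right; simp [hu n h, hu' n h]

theorem Near.add {u' v' : FinSeq} (h : Near u u') (h' : Near v v')
    (hu : SuppBelow N u) (hu' : SuppBelow N u')
    (hv : SuppFrom N v) (hv' : SuppFrom N v') : Near (u + v) (u' + v') := by
  intro n
  rcases add_apply_eq_or hu hu' hv hv' n with ⟨h1, h2⟩ | ⟨h1, h2⟩ <;> rw [h1, h2]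
  exacts [h n, h' n]

theorem Near.refl (a : FinSeq) : Near a a := fun n => by simp

theorem mapRange_add {f : ℤ → ℤ} (hf : f 0 = 0) (hu : SuppBelow N u) (hv : SuppFrom N v) :
    (u + v).mapRange f hf = u.mapRange f hf + v.mapRange f hf := by
  ext n
  rcases lt_or_ge n N with h | h
  · simp [hv n h, hf]
  · simp [hu n h, hf]

/-! Sums of filters -/

theorem mem_sumFilter : D ∈ F ⊹ G ↔ ∀ᶠ u in F, ∀ᶠ v in G, u + v ∈ D := Iff.rfl

theorem eventually_sumFilter {p : FinSeq → Prop} :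
    (∀ᶠ u in F ⊹ G, p u) ↔ ∀ᶠ u in F, ∀ᶠ v in G, p (u + v) := Iff.rfl

@[simp] theorem pure_zero_sumFilter : pure 0 ⊹ F = F := by
  ext D; simp [mem_sumFilter]

@[simp] theorem sumFilter_pure_zero : F ⊹ pure 0 = F := by
  ext D; simp [mem_sumFilter]

theorem IsTail.sumFilter (hF : IsTail F) (hG : IsTail G) : IsTail (F ⊹ G) := fun N => by
  rw [eventually_sumFilter]
  filter_upwards [hF N] with u hu
  filter_upwards [hG N] with v hv using hu.add hv

theorem isTail_pure_zero : IsTail (pure 0) := fun N => by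
  simpa using SuppFrom.zero

theorem IsTail.sup (hF : IsTail F) (hG : IsTail G) : IsTail (F ⊔ G) := fun N =>
  eventually_sup.2 ⟨hF N, hG N⟩

theorem neBot_sumFilter [F.NeBot] [G.NeBot] : (F ⊹ G).NeBot := by
  refine ⟨fun h => ?_⟩
  have : ∅ ∈ F ⊹ G := by rw [h]; exact mem_bot
  obtain ⟨u, hu⟩ := (mem_sumFilter.1 this).exists
  obtain ⟨v, hv⟩ := hu.exists
  exact hv

theorem tendsto_mapRange_sumFilter {f : ℤ → ℤ} (hf : f 0 = 0) (hGt : IsTail G)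
    (h : Tendsto (Finsupp.mapRange f hf) F F') (h' : Tendsto (Finsupp.mapRange f hf) G G') :
    Tendsto (Finsupp.mapRange f hf) (F ⊹ G) (F' ⊹ G') := by
  intro D hD
  rw [mem_sumFilter] at hD
  rw [mem_map, mem_sumFilter]
  filter_upwards [h.eventually hD] with u hu
  obtain ⟨N, hN⟩ := exists_suppBelow u
  filter_upwards [h'.eventually hu, hGt N] with v hv hvN
  rwa [mem_preimage, mapRange_add hf hN hvN]

/-! Shadows -/

theorem Shadows.mono (h : Shadows x F) (hF : G ≤ F) : Shadows x G :=
  fun A hA => (h A hA).filter_mono hF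

theorem Shadows.sup (h : Shadows x F) (h' : Shadows x G) : Shadows x (F ⊔ G) :=
  fun A hA => eventually_sup.2 ⟨h A hA, h' A hA⟩

theorem Shadows.sumFilter (h : Shadows x F) (h' : Shadows y G) (hy : IsTail y) (hG : IsTail G) :
    Shadows (x ⊹ y) (F ⊹ G) := by
  intro A hA
  rw [eventually_sumFilter]
  filter_upwards [h _ (mem_sumFilter.1 hA)] with b hb
  obtain ⟨a, ha, hab⟩ := hb
  obtain ⟨N, hNa, hNb⟩ := exists_suppBelow₂ a b
  filter_upwards [h' _ (inter_mem ha (hy N)), hG N] with b' hb' hbN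
  obtain ⟨a', ha', hab'⟩ := hb'
  exact ⟨a + a', ha'.1, hab.add hab' hNa hNb ha'.2 hbN⟩

theorem shadows_pure_zero : Shadows (pure 0) (pure 0) := by
  intro A hA
  exact ⟨0, hA, Near.refl 0⟩

/-- Idempotents turn shadows of a filter into shadows of a persistent set. -/
theorem exists_persistent_of_shadows (hee : e = e ⊹ e) (he : IsTail e) (heH : Shadows e H)
    (hH : IsTail H) (hxe : x = x ⊹ e) (hx : Shadows x H) {A : Set FinSeq} (hA : A ∈ x) :
    ∃ P ∈ H, (∀ u ∈ P, ∀ᶠ b in H, u + b ∈ P) ∧ ∀ b ∈ P, ∃ a ∈ A, Near a b := by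
  -- Since e is idempotent, e-many c keep a member of this set inside it. The persistent set
  -- consists of all sequences near it.
  let A₁ : Set FinSeq := {a | a ∈ A ∧ ∀ᶠ c in e, a + c ∈ A}
  have hA₁ : A₁ ∈ x := by
    have h' := hA
    rw [hxe, mem_sumFilter] at h'
    exact inter_mem hA h'
  refine ⟨{b | ∃ a ∈ A₁, Near a b}, hx _ hA₁, ?_, fun b ⟨a, ha, hab⟩ => ⟨a, ha.1, hab⟩⟩
  rintro b ⟨a, ha, hab⟩
  obtain ⟨N, hNa, hNb⟩ := exists_suppBelow₂ a b
  have hE : ∀ᶠ c in e, a + c ∈ A₁ ∧ SuppFrom N c := by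
    have h2 : ∀ᶠ c in e ⊹ e, a + c ∈ A := by rw [← hee]; exact ha.2
    filter_upwards [ha.2, eventually_sumFilter.1 h2, he N] with c hc hc' hcN
    exact ⟨⟨hc, by simpa only [add_assoc] using hc'⟩, hcN⟩
  filter_upwards [heH _ hE, hH N] with b' hb' hbN
  obtain ⟨c, ⟨hc, hcN⟩, hcb⟩ := hb'
  exact ⟨a + c, hc, hab.add hcb hNa hNb hcN hbN⟩

end Shadows

/-! ### The filter of generic infinite sums, as a game quantifier -/

section Star

variable {F G H H' x e : Filter FinSeq} {u v : FinSeq} {D : Set FinSeq}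

/-- One step of the game quantifier along `H`, staying in `D`. -/
def stayOp (H : Filter FinSeq) (D : Set FinSeq) : Set FinSeq →o Set FinSeq where
  toFun Z := {u | u ∈ D ∧ ∀ᶠ b in H, u + b ∈ Z}
  monotone' _ _ h _ hu := ⟨hu.1, hu.2.mono fun _ hb => h hb⟩

/-- One step of the game quantifier along `H`, trying to reach `P`. -/
def reachOp (H : Filter FinSeq) (P : Set FinSeq) : Set FinSeq →o Set FinSeq where
  toFun Z := {u | u ∈ P ∨ ∀ᶠ b in H, u + b ∈ Z}
  monotone' _ _ h _ hu := hu.imp id fun hu => hu.mono fun _ hb => h hb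

/-- The points from which generic steps along `H` eventually stay in `D` forever. -/
def absorb (H : Filter FinSeq) (D : Set FinSeq) : Set FinSeq :=
  OrderHom.lfp (reachOp H (OrderHom.gfp (stayOp H D)))

theorem stay_iff : u ∈ OrderHom.gfp (stayOp H D) ↔
    u ∈ D ∧ ∀ᶠ b in H, u + b ∈ OrderHom.gfp (stayOp H D) := by
  conv_lhs => rw [← OrderHom.map_gfp]
  rfl

theorem absorb_iff : u ∈ absorb H D ↔
    u ∈ OrderHom.gfp (stayOp H D) ∨ ∀ᶠ b in H, u + b ∈ absorb H D := by
  conv_lhs => rw [absorb, ← OrderHom.map_lfp]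
  rfl

theorem mem_stay {P : Set FinSeq} (hPD : P ⊆ D) (hP : ∀ u ∈ P, ∀ᶠ b in H, u + b ∈ P)
    (hu : u ∈ P) : u ∈ OrderHom.gfp (stayOp H D) :=
  OrderHom.le_gfp (stayOp H D) (a := P) (fun _ hv => ⟨hPD hv, hP _ hv⟩) hu

theorem absorb_induction {Q : FinSeq → Prop} (h1 : ∀ u ∈ OrderHom.gfp (stayOp H D), Q u)
    (h2 : ∀ u, (∀ᶠ b in H, Q (u + b)) → Q u) (hu : u ∈ absorb H D) : Q u :=
  OrderHom.lfp_le (reachOp H (OrderHom.gfp (stayOp H D))) (a := {u | Q u})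
    (fun v hv => hv.elim (h1 v) (h2 v)) hu

theorem absorb_step (hu : u ∈ absorb H D) : ∀ᶠ b in H, u + b ∈ absorb H D := by
  rcases absorb_iff.1 hu with h | h
  · exact (stay_iff.1 h).2.mono fun b hb => absorb_iff.2 (Or.inl hb)
  · exact h

theorem stay_mono {D' : Set FinSeq} (h : D ⊆ D') :
    OrderHom.gfp (stayOp H D) ⊆ OrderHom.gfp (stayOp H D') := fun _ hu =>
  mem_stay (fun _ hv => h (stay_iff.1 hv).1) (fun _ hv => (stay_iff.1 hv).2) hu

theorem absorb_mono {D' : Set FinSeq} (h : D ⊆ D') : absorb H D ⊆ absorb H D' := fun _ hu =>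
  absorb_induction (fun _ hv => absorb_iff.2 (Or.inl (stay_mono h hv)))
    (fun _ hv => absorb_iff.2 (Or.inr hv)) hu

/-- The two sets may be reached at different times. First wait for D; staying in D is kept along
generic steps, so a second induction waits for D'. -/
theorem absorb_inter {D' : Set FinSeq} (h : u ∈ absorb H D) (h' : u ∈ absorb H D') :
    u ∈ absorb H (D ∩ D') := by
  have key : ∀ v, v ∈ absorb H D' → v ∈ OrderHom.gfp (stayOp H D) → v ∈ absorb H (D ∩ D') := by
    intro v hv
    refine absorb_induction (Q := fun v => v ∈ OrderHom.gfp (stayOp H D) → v ∈ absorb H (D ∩ D'))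
      (fun w hw hw' => absorb_iff.2 (Or.inl ?_)) (fun w hw hw' => absorb_iff.2 (Or.inr ?_)) hv
    · refine mem_stay (P := OrderHom.gfp (stayOp H D) ∩ OrderHom.gfp (stayOp H D')) ?_ ?_ ⟨hw', hw⟩
      · exact fun z hz => ⟨(stay_iff.1 hz.1).1, (stay_iff.1 hz.2).1⟩
      · exact fun z hz => (stay_iff.1 hz.1).2.and (stay_iff.1 hz.2).2
    · filter_upwards [hw, (stay_iff.1 hw').2] with b hb hb' using hb hb'
  refine absorb_induction (Q := fun v => v ∈ absorb H D' → v ∈ absorb H (D ∩ D'))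
    (fun w hw hw' => key w hw' hw) (fun w hw hw' => absorb_iff.2 (Or.inr ?_)) h h'
  filter_upwards [hw, absorb_step hw'] with b hb hb' using hb hb'

/-- The filter of sets in which generic sums along `H` eventually stay. -/
def starFilter (H : Filter FinSeq) : Filter FinSeq where
  sets := {D | 0 ∈ absorb H D}
  univ_sets := absorb_iff.2 (Or.inl (mem_stay (P := univ) subset_rfl (by simp) (mem_univ _)))
  sets_of_superset h h' := absorb_mono h' h
  inter_sets h h' := absorb_inter h h'

theorem mem_starFilter : D ∈ starFilter H ↔ 0 ∈ absorb H D := Iff.rfl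

theorem mem_starFilter_of_persistent {P : Set FinSeq} (hP : ∀ u ∈ P, ∀ᶠ b in H, u + b ∈ P)
    (h0 : 0 ∈ P ∨ P ∈ H) : P ∈ starFilter H := by
  have key : ∀ u ∈ P, u ∈ absorb H P := fun u hu =>
    absorb_iff.2 (Or.inl (mem_stay subset_rfl hP hu))
  refine h0.elim (fun h => key 0 h) fun h => absorb_iff.2 (Or.inr ?_)
  filter_upwards [h] with b hb
  rw [zero_add]
  exact key b hb

theorem absorb_of_shift (h : v ∈ absorb H {v | u + v ∈ D}) : u + v ∈ absorb H D := by
  refine absorb_induction (Q := fun v => u + v ∈ absorb H D) (fun w hw => ?_) (fun w hw => ?_) h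
  · refine absorb_iff.2 (Or.inl (mem_stay
      (P := {z | ∃ w ∈ OrderHom.gfp (stayOp H {v | u + v ∈ D}), u + w = z}) ?_ ?_ ⟨w, hw, rfl⟩))
    · rintro _ ⟨w, hw, rfl⟩
      exact (stay_iff.1 hw).1
    · rintro _ ⟨w, hw, rfl⟩
      filter_upwards [(stay_iff.1 hw).2] with b hb using ⟨w + b, hb, by rw [add_assoc]⟩
  · exact absorb_iff.2 (Or.inr (hw.mono fun b hb => by rwa [add_assoc]))

/-- Concatenating two generic plays gives a generic play: by translation, the first play is absorbed
into `absorb H D`, and reaching a point from which D is reached is reaching D. -/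
theorem starFilter_le_sumFilter : starFilter H ≤ starFilter H ⊹ starFilter H := by
  intro D hD
  have h : 0 ∈ absorb H (absorb H D) := by
    rw [mem_sumFilter] at hD
    refine mem_starFilter.1 (Filter.mem_of_superset hD fun u hu => ?_)
    have := absorb_of_shift (mem_starFilter.1 (hu : {v | u + v ∈ D} ∈ starFilter H))
    rwa [add_zero] at this
  exact absorb_induction (fun w hw => (stay_iff.1 hw).1)
    (fun w hw => absorb_iff.2 (Or.inr hw)) h

theorem neBot_starFilter [H.NeBot] : (starFilter H).NeBot := by
  refine ⟨fun h => ?_⟩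
  have : ∅ ∈ starFilter H := by rw [h]; exact mem_bot
  exact absorb_induction (Q := fun _ => False) (fun w hw => (stay_iff.1 hw).1)
    (fun w hw => NeBot.ne ‹_› (by simpa using hw)) (mem_starFilter.1 this)

theorem IsTail.starFilter (hH : IsTail H) : IsTail (starFilter H) := fun N =>
  mem_starFilter_of_persistent (P := {u | SuppFrom N u})
    (fun _ hu => (hH N).mono fun _ hb => SuppFrom.add hu hb) (Or.inl SuppFrom.zero)

theorem tendsto_mapRange_starFilter {f : ℤ → ℤ} (hf : f 0 = 0) (hH : IsTail H)
    (h : Tendsto (Finsupp.mapRange f hf) H H') :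
    Tendsto (Finsupp.mapRange f hf) (starFilter H) (starFilter H') := by
  have hadd : ∀ {u : FinSeq} {Z : Set FinSeq}, (∀ᶠ b in H', Finsupp.mapRange f hf u + b ∈ Z) →
      ∀ᶠ b in H, Finsupp.mapRange f hf (u + b) ∈ Z := by
    intro u Z hu
    obtain ⟨N, hN⟩ := exists_suppBelow u
    filter_upwards [h.eventually hu, hH N] with b hb hbN
    rwa [mapRange_add hf hN hbN]
  intro D hD
  have key : ∀ u, Finsupp.mapRange f hf u = 0 → u ∈ absorb H (Finsupp.mapRange f hf ⁻¹' D) := by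
    refine absorb_induction (Q := fun v => ∀ u, Finsupp.mapRange f hf u = v →
      u ∈ absorb H (Finsupp.mapRange f hf ⁻¹' D)) ?_ ?_ (mem_starFilter.1 hD)
    · rintro _ hu u rfl
      refine absorb_iff.2 (Or.inl (mem_stay
        (P := Finsupp.mapRange f hf ⁻¹' OrderHom.gfp (stayOp H' D)) ?_ ?_ hu))
      · exact fun v hv => (stay_iff.1 hv).1
      · exact fun v hv => hadd (stay_iff.1 hv).2
    · rintro _ hu u rfl
      refine absorb_iff.2 (Or.inr ?_)
      have := hadd (Z := {v | ∀ u, Finsupp.mapRange f hf u = v →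
        u ∈ absorb H (Finsupp.mapRange f hf ⁻¹' D)}) hu
      exact this.mono fun b hb => hb _ rfl
  exact key 0 (by simp)

theorem Shadows.starFilter (hee : e = e ⊹ e) (he : IsTail e) (heH : Shadows e H)
    (hH : IsTail H) (hxe : x = x ⊹ e) (hx : Shadows x H) : Shadows x (starFilter H) := by
  intro A hA
  obtain ⟨P, hPH, hP, hPA⟩ := exists_persistent_of_shadows hee he heH hH hxe hx hA
  exact Filter.mem_of_superset (mem_starFilter_of_persistent hP (Or.inr hPH)) hPA

end Star

/-! ### Path filters -/

section Paths

/-- The sequence with constant value `v` on `[t, e)`. -/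
noncomputable def seg (v : ℤ) (t e : ℕ) : FinSeq :=
  Finsupp.onFinset (Finset.Ico t e) (fun n => if t ≤ n ∧ n < e then v else 0) (by
    intro n hn
    simp only [ne_eq, ite_eq_right_iff, not_forall] at hn
    simpa using hn.1)

theorem seg_apply (v : ℤ) (t e n : ℕ) : seg v t e n = if t ≤ n ∧ n < e then v else 0 := rfl

/-- Generic step functions taking the listed values in turn, starting at `t`, with breakpoints
chosen along `𝓤`. -/
noncomputable def pathFilter (𝓤 : Filter ℕ) : List ℤ → ℕ → Filter FinSeq
  | [], _ => pure 0
  | v :: vs, t => 𝓤.bind fun e => (pathFilter 𝓤 vs e).map (seg v t e + ·)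

variable {𝓤 : Filter ℕ} {vs vs' : List ℤ} {v : ℤ} {t e : ℕ} {p : FinSeq → Prop} {D : Set FinSeq}

theorem mem_pathFilter_cons : D ∈ pathFilter 𝓤 (v :: vs) t ↔
    ∀ᶠ e in 𝓤, ∀ᶠ u in pathFilter 𝓤 vs e, seg v t e + u ∈ D := Iff.rfl

theorem eventually_pathFilter_cons : (∀ᶠ u in pathFilter 𝓤 (v :: vs) t, p u) ↔
    ∀ᶠ e in 𝓤, ∀ᶠ u in pathFilter 𝓤 vs e, p (seg v t e + u) := Iff.rfl

@[simp] theorem seg_zero : seg 0 t e = 0 := by ext n; simp [seg_apply]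

theorem suppBelow_seg : SuppBelow e (seg v t e) := fun n hn => by
  rw [seg_apply, if_neg (by omega)]

theorem suppFrom_seg : SuppFrom t (seg v t e) := fun n hn => by
  rw [seg_apply, if_neg (by omega)]

theorem seg_add_seg {e' : ℕ} (h : t ≤ e) (h' : e ≤ e') : seg v t e + seg v e e' = seg v t e' := by
  ext n
  simp only [Finsupp.add_apply, seg_apply]
  split_ifs <;> first | rfl | omega

theorem eventually_suppFrom_pathFilter (h𝓤 : 𝓤 ≤ atTop) (vs : List ℤ) (t : ℕ) :
    ∀ᶠ u in pathFilter 𝓤 vs t, SuppFrom t u := by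
  induction vs generalizing t with
  | nil => exact SuppFrom.zero
  | cons v vs ih =>
    rw [eventually_pathFilter_cons]
    filter_upwards [h𝓤 (eventually_ge_atTop t)] with e he
    filter_upwards [ih e] with u hu using suppFrom_seg.add (hu.mono he)

/-- The next breakpoint generically lies beyond e, so a later start only cuts off a part of the
first piece. -/
theorem mem_pathFilter_shift (h𝓤 : 𝓤 ≤ atTop) (h : t ≤ e) : D ∈ pathFilter 𝓤 vs t ↔
    ∀ᶠ b in pathFilter 𝓤 vs e, seg (vs.headD 0) t e + b ∈ D := by
  cases vs with
  | nil => simp [pathFilter]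
  | cons v vs =>
    rw [mem_pathFilter_cons, eventually_pathFilter_cons]
    refine eventually_congr ?_
    filter_upwards [h𝓤 (eventually_ge_atTop e)] with e' he'
    simp only [List.headD_cons, ← add_assoc, seg_add_seg h he']

theorem pathFilter_head_le (h𝓤 : 𝓤 ≤ atTop) :
    pathFilter 𝓤 (vs.headD 0 :: vs) t ≤ pathFilter 𝓤 vs t := by
  intro D hD
  rw [mem_pathFilter_cons]
  filter_upwards [h𝓤 (eventually_ge_atTop t)] with e he
  exact (mem_pathFilter_shift h𝓤 he).1 hD

theorem pathFilter_append_le (l : List ℤ) (h : ∀ t, pathFilter 𝓤 vs t ≤ pathFilter 𝓤 vs' t)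
    (t : ℕ) : pathFilter 𝓤 (l ++ vs) t ≤ pathFilter 𝓤 (l ++ vs') t := by
  induction l generalizing t with
  | nil => exact h t
  | cons v l ih =>
    intro D hD
    rw [List.cons_append, mem_pathFilter_cons] at hD ⊢
    exact hD.mono fun e he => ih e he

theorem neBot_pathFilter [𝓤.NeBot] (vs : List ℤ) (t : ℕ) : (pathFilter 𝓤 vs t).NeBot := by
  induction vs generalizing t with
  | nil => exact pure_neBot
  | cons v vs ih =>
    refine ⟨fun h => ?_⟩
    have : ∅ ∈ pathFilter 𝓤 (v :: vs) t := by rw [h]; exact mem_bot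
    obtain ⟨e, he⟩ := (mem_pathFilter_cons.1 this).exists
    exact (ih e).ne (by simpa using he)

theorem exists_ultrafilter_eq_pathFilter (𝒰 : Ultrafilter ℕ) (vs : List ℤ) (t : ℕ) :
    ∃ g : Ultrafilter FinSeq, (g : Filter FinSeq) = pathFilter 𝒰 vs t := by
  induction vs generalizing t with
  | nil => exact ⟨pure 0, rfl⟩
  | cons v vs ih =>
    choose g hg using ih
    refine ⟨𝒰.bind fun e => (g e).map (seg v t e + ·), ?_⟩
    ext D
    rw [mem_pathFilter_cons]
    simp only [← hg]
    rfl

theorem tendsto_mapRange_pathFilter (h𝓤 : 𝓤 ≤ atTop) {f : ℤ → ℤ} (hf : f 0 = 0) (vs : List ℤ)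
    (t : ℕ) :
    Tendsto (Finsupp.mapRange f hf) (pathFilter 𝓤 vs t) (pathFilter 𝓤 (vs.map f) t) := by
  have hseg : ∀ v t e, Finsupp.mapRange f hf (seg v t e) = seg (f v) t e := by
    intro v t e
    ext n
    simp only [Finsupp.mapRange_apply, seg_apply]
    split_ifs <;> simp [hf]
  induction vs generalizing t with
  | nil => simp [pathFilter]
  | cons v vs ih =>
    intro D hD
    rw [List.map_cons, mem_pathFilter_cons] at hD
    rw [mem_map, mem_pathFilter_cons]
    filter_upwards [hD] with e he
    filter_upwards [(ih e).eventually he, eventually_suppFrom_pathFilter h𝓤 vs e] with u hu hue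
    rwa [mem_preimage, mapRange_add hf suppBelow_seg hue, hseg]

theorem eventually_abs_le_pathFilter (h𝓤 : 𝓤 ≤ atTop) {m : ℕ} (vs : List ℤ)
    (h : ∀ v ∈ vs, |v| ≤ (m : ℤ)) (t : ℕ) :
    ∀ᶠ u in pathFilter 𝓤 vs t, ∀ n, |u n| ≤ (m : ℤ) := by
  induction vs generalizing t with
  | nil => exact fun n => by simp
  | cons v vs ih =>
    rw [eventually_pathFilter_cons]
    refine Eventually.of_forall fun e => ?_
    filter_upwards [ih (fun v hv => h v (by simp [hv])) e,
      eventually_suppFrom_pathFilter h𝓤 vs e] with u hu hue n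
    rcases add_apply_eq_or (suppBelow_seg (v := v) (t := t)) (suppBelow_seg (v := v) (t := t)) hue hue n with h1 | h1
    · rw [h1.1, seg_apply]
      split_ifs
      · exact h v (by simp)
      · simp
    · rw [h1.1]; exact hu n

theorem eventually_exists_eq_pathFilter (h𝓤 : 𝓤 ≤ atTop) (hv : v ∈ vs) (t : ℕ) :
    ∀ᶠ u in pathFilter 𝓤 vs t, ∃ n ≥ t, u n = v := by
  induction vs generalizing t with
  | nil => simp at hv
  | cons w vs ih =>
    rw [eventually_pathFilter_cons]
    filter_upwards [h𝓤 (eventually_gt_atTop t)] with e he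
    rcases List.mem_cons.1 hv with rfl | hv
    · filter_upwards [eventually_suppFrom_pathFilter h𝓤 vs e] with u hu
      exact ⟨t, le_rfl, by simp [hu t he, seg_apply, he]⟩
    · filter_upwards [eventually_suppFrom_pathFilter h𝓤 vs e, ih hv e] with u hu hun
      obtain ⟨n, hen, hn⟩ := hun
      exact ⟨n, by omega, by simp [suppBelow_seg n hen, hn]⟩

/-- Step functions with these values can be run side by side, within distance one. -/
inductive PathNear : List ℤ → List ℤ → Prop
  | nil : PathNear [] []
  | left {v : ℤ} {vs vs' : List ℤ} : |v - vs'.headD 0| ≤ 1 → PathNear vs vs' →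
      PathNear (v :: vs) vs'
  | right {v : ℤ} {vs vs' : List ℤ} : |vs.headD 0 - v| ≤ 1 → PathNear vs vs' →
      PathNear vs (v :: vs')

theorem near_seg {v v' : ℤ} (h : |v - v'| ≤ 1) : Near (seg v t e) (seg v' t e) := by
  intro n
  simp only [seg_apply]
  split_ifs <;> simp [h]

/-- Breakpoints of the right path are given and those of the left path are chosen. While one path
finishes a piece, the other prolongs its current value, which `PathNear` keeps within one. -/
theorem PathNear.shadows (h : PathNear vs vs') (h𝓤 : 𝓤 ≤ atTop) [𝓤.NeBot] (t : ℕ) :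
    Shadows (pathFilter 𝓤 vs t) (pathFilter atTop vs' t) := by
  induction h generalizing t with
  | nil => exact shadows_pure_zero
  | @left v vs vs' h _ ih =>
    intro A hA
    obtain ⟨e, he, hte⟩ := ((mem_pathFilter_cons.1 hA).and (h𝓤 (eventually_ge_atTop t))).exists
    refine (mem_pathFilter_shift le_rfl hte).2 ?_
    filter_upwards [ih e _ (inter_mem he (eventually_suppFrom_pathFilter h𝓤 vs e)),
      eventually_suppFrom_pathFilter le_rfl vs' e] with b hb hbe
    obtain ⟨a, ha, hab⟩ := hb
    exact ⟨_, ha.1, (near_seg h).add hab suppBelow_seg suppBelow_seg ha.2 hbe⟩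
  | @right v vs vs' h _ ih =>
    intro A hA
    rw [eventually_pathFilter_cons]
    filter_upwards [eventually_ge_atTop t] with e hte
    have he := (mem_pathFilter_shift h𝓤 hte).1 hA
    filter_upwards [ih e _ (inter_mem he (eventually_suppFrom_pathFilter h𝓤 vs e)),
      eventually_suppFrom_pathFilter le_rfl vs' e] with b hb hbe
    obtain ⟨a, ha, hab⟩ := hb
    exact ⟨_, ha.1, (near_seg h).add hab suppBelow_seg suppBelow_seg ha.2 hbe⟩

theorem headD_map_mul (s : ℤ) (l : List ℤ) : (l.map (s * ·)).headD 0 = s * l.headD 0 := by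
  cases l <;> simp

theorem PathNear.map_mul {s : ℤ} (hs : |s| ≤ 1) (h : PathNear vs vs') :
    PathNear (vs.map (s * ·)) (vs'.map (s * ·)) := by
  have key : ∀ a b : ℤ, |a - b| ≤ 1 → |s * a - s * b| ≤ 1 := fun a b hab => by
    rw [← mul_sub, abs_mul]
    exact mul_le_one₀ hs (abs_nonneg _) hab
  induction h with
  | nil => exact .nil
  | left h _ ih => exact .left (by rw [headD_map_mul]; exact key _ _ h) ih
  | right h _ ih => exact .right (by rw [headD_map_mul]; exact key _ _ h) ih

theorem PathNear.cons_cons (hv : |v - vs'.headD 0| ≤ 1) (h : PathNear vs vs') :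
    PathNear (v :: vs) (v :: vs') := .right (by simp) (.left hv h)

/-- The list `i, i + 1, …, i + n - 1`. -/
def ascent (i : ℤ) : ℕ → List ℤ
  | 0 => []
  | n + 1 => i :: ascent (i + 1) n

/-- The list `m, m - 1, …, 1`. -/
def descent : ℕ → List ℤ
  | 0 => []
  | m + 1 => ((m + 1 : ℕ) : ℤ) :: descent m

/-- The list `0, 1, …, m - 1, m, m - 1, …, 1`. -/
def hill (m : ℕ) : List ℤ := ascent 0 m ++ descent m

theorem ascent_succ (i : ℤ) (n : ℕ) : ascent i (n + 1) = ascent i n ++ [i + n] := by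
  induction n generalizing i with
  | zero => simp [ascent]
  | succ n ih =>
    rw [ascent, ih, ascent]
    simp only [List.cons_append, List.cons.injEq, true_and, List.append_cancel_left_eq, and_true]
    push_cast
    ring

theorem headD_descent (m : ℕ) : (descent m).headD 0 = m := by cases m <;> simp [descent]

theorem pathNear_descent (m : ℕ) : PathNear (descent m) (descent m) := by
  induction m with
  | zero => exact .nil
  | succ m ih => exact .cons_cons (by rw [headD_descent]; simp) ih

theorem headD_ascent_append (i : ℤ) (n : ℕ) (h : vs.headD 0 = i + n) :
    (ascent i n ++ vs).headD 0 = i := by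
  cases n with
  | zero => simpa [ascent] using h
  | succ n => simp [ascent]

theorem PathNear.ascent_append (i : ℤ) (n : ℕ) (h' : vs'.headD 0 = i + n) (h : PathNear vs vs') :
    PathNear (ascent i n ++ vs) (ascent i n ++ vs') := by
  induction n generalizing i with
  | zero => exact h
  | succ n ih =>
    have h'' : vs'.headD 0 = i + 1 + n := by rw [h']; push_cast; ring
    refine .cons_cons ?_ (ih (i + 1) h'')
    change |i - (ascent (i + 1) n ++ vs').headD 0| ≤ 1
    rw [headD_ascent_append _ _ h'']
    simp

/-- Compared with `hill m`, only the two pieces m, m + 1 before the descent are new; both are within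
one of the value m at which the lower hill waits. -/
theorem hill_succ (m : ℕ) :
    hill (m + 1) = ascent 0 m ++ ((m : ℤ) :: ((m + 1 : ℕ) : ℤ) :: descent m) := by
  simp [hill, ascent_succ, descent]

theorem pathNear_hill {l m : ℕ} (h : l = m ∨ l = m + 1 ∨ m = l + 1) :
    PathNear (hill l) (hill m) := by
  rcases h with rfl | rfl | rfl
  · exact .ascent_append _ _ (by rw [headD_descent]; simp) (pathNear_descent l)
  · rw [hill_succ]
    refine .ascent_append _ _ (by rw [headD_descent]; simp) (.left ?_ (.left ?_
      (pathNear_descent m))) <;> rw [headD_descent] <;> simp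
  · rw [hill_succ]
    refine .ascent_append _ _ (by simp) (.right ?_ (.right ?_
      (pathNear_descent l))) <;> rw [headD_descent] <;> simp

theorem abs_le_of_mem_hill {m : ℕ} (h : v ∈ hill m) : |v| ≤ m := by
  have ha : ∀ (n : ℕ) (i : ℤ), v ∈ ascent i n → i ≤ v ∧ v ≤ i + n := by
    intro n
    induction n with
    | zero => simp [ascent]
    | succ n ih =>
      intro i hi
      rcases List.mem_cons.1 hi with rfl | hi
      · push_cast; constructor <;> linarith
      · have := ih _ hi; push_cast; constructor <;> linarith
  have hd : ∀ m : ℕ, v ∈ descent m → 0 ≤ v ∧ v ≤ m := by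
    intro m
    induction m with
    | zero => simp [descent]
    | succ n ih =>
      intro hi
      rcases List.mem_cons.1 hi with rfl | hi
      · push_cast; constructor <;> linarith
      · have := ih hi; push_cast; constructor <;> linarith
  rcases List.mem_append.1 h with h | h
  · have := ha _ _ h; rw [abs_of_nonneg this.1]; linarith
  · have := hd _ h; rw [abs_of_nonneg this.1]; exact this.2

theorem map_tetrisValue_hill (m : ℕ) {s : ℤ} (hs : s = 1 ∨ s = -1) :
    ((hill (m + 1)).map (s * ·)).map tetrisValue =
      0 :: ((hill m).map (s * ·) ++ [0]) := by
  have hT : ∀ n : ℤ, 0 ≤ n → tetrisValue (s * (n + 1)) = s * n := by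
    intro n hn
    rcases hs with rfl | rfl <;> simp only [tetrisValue] <;> split_ifs <;> linarith
  have ha : ∀ (n : ℕ) (i : ℤ), 0 ≤ i → ((ascent (i + 1) n).map (s * ·)).map tetrisValue =
      (ascent i n).map (s * ·) := by
    intro n
    induction n with
    | zero => simp [ascent]
    | succ n ih =>
      intro i hi
      simp only [ascent, List.map_cons, hT i hi]
      rw [ih (i + 1) (by linarith)]
  have hd : ∀ n : ℕ, ((descent (n + 1)).map (s * ·)).map tetrisValue =
      (descent n).map (s * ·) ++ [0] := by
    intro n
    induction n with
    | zero =>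
      have := hT 0 le_rfl
      simpa [descent] using this
    | succ n ih =>
      have := hT ((n + 1 : ℕ) : ℤ) (by positivity)
      rw [descent, List.map_cons, List.map_cons, ih, descent]
      push_cast at this ⊢
      simp [this]
  rw [hill, hill, List.map_append, List.map_append, hd, ascent, List.map_cons, List.map_cons,
    ha m 0 le_rfl]
  simp [tetrisValue]

theorem tetris_eq_mapRange :
    tetris = Finsupp.mapRange tetrisValue (by simp [tetrisValue]) := rfl

/-- Generic hills of height `m` and sign `s`. -/
noncomputable def hillFilter (𝓤 : Filter ℕ) (m : ℕ) (s : ℤ) : Filter FinSeq :=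
  pathFilter 𝓤 ((hill m).map (s * ·)) 0

theorem isTail_hillFilter (h𝓤 : 𝓤 ≤ atTop) (m : ℕ) (s : ℤ) : IsTail (hillFilter 𝓤 m s) := by
  intro N
  cases m with
  | zero => exact SuppFrom.zero
  | succ m =>
    simp only [hillFilter, hill, ascent, List.cons_append, List.map_cons]
    rw [eventually_pathFilter_cons]
    filter_upwards [h𝓤 (eventually_ge_atTop N)] with e he
    filter_upwards [eventually_suppFrom_pathFilter h𝓤 _ e] with u hu
    simpa using hu.mono he

theorem shadows_hillFilter (h𝓤 : 𝓤 ≤ atTop) [𝓤.NeBot] {l m : ℕ}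
    (h : l = m ∨ l = m + 1 ∨ m = l + 1) {s : ℤ} (hs : |s| ≤ 1) :
    Shadows (hillFilter 𝓤 l s) (hillFilter atTop m s) :=
  ((pathNear_hill h).map_mul hs).shadows h𝓤 0

theorem abs_le_hillFilter (h𝓤 : 𝓤 ≤ atTop) (m : ℕ) {s : ℤ} (hs : |s| ≤ 1) :
    ∀ᶠ u in hillFilter 𝓤 m s, ∀ n, |u n| ≤ (m : ℤ) := by
  refine eventually_abs_le_pathFilter h𝓤 _ (fun v hv => ?_) 0
  obtain ⟨w, hw, rfl⟩ := List.mem_map.1 hv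
  rw [abs_mul]
  exact (mul_le_of_le_one_left (abs_nonneg _) hs).trans (abs_le_of_mem_hill hw)

theorem exists_abs_eq_hillFilter (h𝓤 : 𝓤 ≤ atTop) (m : ℕ) {s : ℤ} (hs : |s| = 1) :
    ∀ᶠ u in hillFilter 𝓤 (m + 1) s, ∃ n, |u n| = ((m + 1 : ℕ) : ℤ) := by
  have hm : s * ((m + 1 : ℕ) : ℤ) ∈ (hill (m + 1)).map (s * ·) :=
    List.mem_map_of_mem (by simp [hill_succ])
  filter_upwards [eventually_exists_eq_pathFilter h𝓤 hm 0] with u hu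
  obtain ⟨n, -, hn⟩ := hu
  exact ⟨n, by rw [hn, abs_mul, hs, one_mul, abs_of_nonneg (by positivity)]⟩

theorem tendsto_neg_hillFilter (h𝓤 : 𝓤 ≤ atTop) (m : ℕ) (s : ℤ) :
    Tendsto (Finsupp.mapRange (fun z : ℤ => -z) neg_zero) (hillFilter 𝓤 m s)
      (hillFilter 𝓤 m (-s)) := by
  have := tendsto_mapRange_pathFilter h𝓤 (f := fun z : ℤ => -z) neg_zero ((hill m).map (s * ·)) 0
  rw [List.map_map] at this
  have h : ((fun z : ℤ => -z) ∘ fun x => s * x) = fun x => -s * x := by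
    funext z
    simp
  rwa [h] at this

/-- T turns the pieces 0, s at the start into 0, 0 and the final piece s into 0. Repeated values
merge, and what remains is the hill one lower. -/
theorem tendsto_tetris_hillFilter (h𝓤 : 𝓤 ≤ atTop) (m : ℕ) {s : ℤ} (hs : s = 1 ∨ s = -1) :
    Tendsto tetris (hillFilter 𝓤 (m + 1) s) (hillFilter 𝓤 m s) := by
  have h0 : ((hill m).map (s * ·) ++ [0]).headD 0 = 0 := by
    cases m <;> simp [hill, ascent, descent]
  have h1 := pathFilter_head_le h𝓤 (vs := (hill m).map (s * ·) ++ [0]) (t := 0)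
  have h2 := pathFilter_append_le (𝓤 := 𝓤) (vs := [0]) (vs' := []) ((hill m).map (s * ·))
    (fun t => pathFilter_head_le (vs := []) h𝓤) 0
  rw [h0] at h1
  rw [List.append_nil] at h2
  have h := tendsto_mapRange_pathFilter h𝓤 (f := tetrisValue) (by simp [tetrisValue])
    ((hill (m + 1)).map (s * ·)) 0
  rw [map_tetrisValue_hill m hs] at h
  rw [tetris_eq_mapRange, hillFilter, hillFilter]
  exact h.mono_right (h1.trans h2)

end Paths

/-! ### The filters of generic hill sums -/

section TowerFilter

variable {F G H K : Filter FinSeq} {u v : FinSeq} {m : ℕ}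

/-- Hills of heights `m` of sign `s`, then `-s`, separated by elements of `K`. -/
noncomputable def twinFilter (K : Filter FinSeq) (m : ℕ) (s : ℤ) : Filter FinSeq :=
  K ⊹ hillFilter atTop m s ⊹ K ⊹ hillFilter atTop m (-s) ⊹ K

/-- The filter generated by twin hills of both orders. -/
noncomputable def stepFilter (K : Filter FinSeq) (m : ℕ) : Filter FinSeq :=
  twinFilter K m 1 ⊔ twinFilter K m (-1)

/-- The filter of generic sums of hills of height `m`, of both signs. -/
noncomputable def towerFilter : ℕ → Filter FinSeq
  | 0 => pure 0
  | m + 1 => starFilter (stepFilter (towerFilter m) (m + 1))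

theorem IsTail.twinFilter (hK : IsTail K) (m : ℕ) (s : ℤ) : IsTail (twinFilter K m s) :=
  (((hK.sumFilter (isTail_hillFilter le_rfl m s)).sumFilter hK).sumFilter
    (isTail_hillFilter le_rfl m (-s))).sumFilter hK

theorem IsTail.stepFilter (hK : IsTail K) (m : ℕ) : IsTail (stepFilter K m) :=
  (hK.twinFilter m 1).sup (hK.twinFilter m (-1))

theorem isTail_towerFilter : ∀ m, IsTail (towerFilter m)
  | 0 => isTail_pure_zero
  | m + 1 => ((isTail_towerFilter m).stepFilter (m + 1)).starFilter

theorem neBot_twinFilter [K.NeBot] (m : ℕ) (s : ℤ) : (twinFilter K m s).NeBot := by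
  have h (s : ℤ) : (hillFilter atTop m s).NeBot := neBot_pathFilter _ _
  have h1 := h s
  have h2 := h (-s)
  have : (K ⊹ hillFilter atTop m s).NeBot := neBot_sumFilter
  have : (K ⊹ hillFilter atTop m s ⊹ K).NeBot := neBot_sumFilter
  have : (K ⊹ hillFilter atTop m s ⊹ K ⊹ hillFilter atTop m (-s)).NeBot := neBot_sumFilter
  exact neBot_sumFilter

theorem neBot_towerFilter : ∀ m, (towerFilter m).NeBot
  | 0 => pure_neBot
  | m + 1 => by
    have := neBot_towerFilter m
    have h1 := neBot_twinFilter (K := towerFilter m) (m + 1) 1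
    have : (stepFilter (towerFilter m) (m + 1)).NeBot := h1.mono le_sup_left
    exact neBot_starFilter

theorem towerFilter_le_sumFilter : ∀ m, towerFilter m ≤ towerFilter m ⊹ towerFilter m
  | 0 => by rw [towerFilter, pure_zero_sumFilter]
  | _ + 1 => starFilter_le_sumFilter

theorem abs_le_add (hu : ∀ n, |u n| ≤ (m : ℤ)) (hv : ∀ n, |v n| ≤ (m : ℤ)) {N : ℕ}
    (huN : SuppBelow N u) (hvN : SuppFrom N v) (n : ℕ) : |(u + v) n| ≤ (m : ℤ) := by
  rcases add_apply_eq_or huN huN hvN hvN n with h | h <;> rw [h.1]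
  exacts [hu n, hv n]

theorem eventually_abs_le_sumFilter (hF : ∀ᶠ u in F, ∀ n, |u n| ≤ (m : ℤ))
    (hG : ∀ᶠ u in G, ∀ n, |u n| ≤ (m : ℤ)) (hGt : IsTail G) :
    ∀ᶠ u in F ⊹ G, ∀ n, |u n| ≤ (m : ℤ) := by
  rw [eventually_sumFilter]
  filter_upwards [hF] with u hu
  obtain ⟨N, hN⟩ := exists_suppBelow u
  filter_upwards [hG, hGt N] with v hv hvN using abs_le_add hu hv hN hvN

theorem exists_abs_add (hu : ∃ n, |u n| = (m : ℤ)) (hm : 0 < m) {N : ℕ}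
    (huN : SuppBelow N u) (hvN : SuppFrom N v) : ∃ n, |(u + v) n| = (m : ℤ) := by
  obtain ⟨n, hn⟩ := hu
  refine ⟨n, ?_⟩
  rcases lt_or_ge n N with h | h
  · simpa [hvN n h] using hn
  · rw [huN n h] at hn
    simp at hn
    omega

theorem exists_abs_add' (hv : ∃ n, |v n| = (m : ℤ)) (hm : 0 < m) {N : ℕ}
    (huN : SuppBelow N u) (hvN : SuppFrom N v) : ∃ n, |(u + v) n| = (m : ℤ) := by
  obtain ⟨n, hn⟩ := hv
  refine ⟨n, ?_⟩
  rcases lt_or_ge n N with h | h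
  · rw [hvN n h] at hn
    simp at hn
    omega
  · simpa [huN n h] using hn

theorem eventually_exists_abs_sumFilter (hF : ∀ᶠ u in F, ∃ n, |u n| = (m : ℤ)) (hm : 0 < m)
    (hGt : IsTail G) : ∀ᶠ u in F ⊹ G, ∃ n, |u n| = (m : ℤ) := by
  rw [eventually_sumFilter]
  filter_upwards [hF] with u hu
  obtain ⟨N, hN⟩ := exists_suppBelow u
  filter_upwards [hGt N] with v hvN using exists_abs_add hu hm hN hvN

theorem eventually_exists_abs_sumFilter' (hG : ∀ᶠ u in G, ∃ n, |u n| = (m : ℤ)) (hm : 0 < m)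
    (hGt : IsTail G) : ∀ᶠ u in F ⊹ G, ∃ n, |u n| = (m : ℤ) := by
  rw [eventually_sumFilter]
  refine Eventually.of_forall fun u => ?_
  obtain ⟨N, hN⟩ := exists_suppBelow u
  filter_upwards [hG, hGt N] with v hv hvN using exists_abs_add' hv hm hN hvN

theorem eventually_abs_le_towerFilter : ∀ m : ℕ, ∀ᶠ u in towerFilter m, ∀ n, |u n| ≤ (m : ℤ)
  | 0 => fun n => by simp
  | m + 1 => by
    have hKt := isTail_towerFilter m
    have hK : ∀ᶠ u in towerFilter m, ∀ n, |u n| ≤ ((m + 1 : ℕ) : ℤ) :=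
      (eventually_abs_le_towerFilter m).mono fun u hu n => (hu n).trans (by push_cast; linarith)
    have htw : ∀ s : ℤ, |s| ≤ 1 → ∀ᶠ u in twinFilter (towerFilter m) (m + 1) s,
        ∀ n, |u n| ≤ ((m + 1 : ℕ) : ℤ) := fun s hs =>
      eventually_abs_le_sumFilter (eventually_abs_le_sumFilter (eventually_abs_le_sumFilter
        (eventually_abs_le_sumFilter hK (abs_le_hillFilter le_rfl _ hs)
          (isTail_hillFilter le_rfl _ _)) hK hKt)
        (abs_le_hillFilter le_rfl _ (by rwa [abs_neg])) (isTail_hillFilter le_rfl _ _)) hK hKt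
    have hst : ∀ᶠ u in stepFilter (towerFilter m) (m + 1), ∀ n, |u n| ≤ ((m + 1 : ℕ) : ℤ) :=
      eventually_sup.2 ⟨htw 1 (by simp), htw (-1) (by simp)⟩
    refine mem_starFilter_of_persistent (fun u hu => ?_) (Or.inl fun n => by simp; positivity)
    obtain ⟨N, hN⟩ := exists_suppBelow u
    filter_upwards [hst, hKt.stepFilter (m + 1) N] with v hv hvN using abs_le_add hu hv hN hvN

theorem eventually_exists_abs_towerFilter (m : ℕ) :
    ∀ᶠ u in towerFilter (m + 1), ∃ n, |u n| = ((m + 1 : ℕ) : ℤ) := by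
  have hKt := isTail_towerFilter m
  have htw : ∀ s : ℤ, |s| = 1 → ∀ᶠ u in twinFilter (towerFilter m) (m + 1) s,
      ∃ n, |u n| = ((m + 1 : ℕ) : ℤ) := fun s hs =>
    eventually_exists_abs_sumFilter (eventually_exists_abs_sumFilter'
      (exists_abs_eq_hillFilter le_rfl _ (by rwa [abs_neg])) (by omega)
        (isTail_hillFilter le_rfl _ _)) (by omega) hKt
  have hst : ∀ᶠ u in stepFilter (towerFilter m) (m + 1), ∃ n, |u n| = ((m + 1 : ℕ) : ℤ) :=
    eventually_sup.2 ⟨htw 1 (by simp), htw (-1) (by simp)⟩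
  refine mem_starFilter_of_persistent (fun u hu => ?_) (Or.inr hst)
  obtain ⟨N, hN⟩ := exists_suppBelow u
  filter_upwards [hKt.stepFilter (m + 1) N] with v hvN using
    exists_abs_add hu (by omega) hN hvN

theorem tendsto_mapRange_twinFilter {f : ℤ → ℤ} (hf : f 0 = 0) {K' : Filter FinSeq} {m' : ℕ}
    {s s' : ℤ} (hK : IsTail K) (h : Tendsto (Finsupp.mapRange f hf) K K')
    (h₁ : Tendsto (Finsupp.mapRange f hf) (hillFilter atTop m s) (hillFilter atTop m' s'))
    (h₂ : Tendsto (Finsupp.mapRange f hf) (hillFilter atTop m (-s)) (hillFilter atTop m' (-s'))) :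
    Tendsto (Finsupp.mapRange f hf) (twinFilter K m s) (twinFilter K' m' s') :=
  tendsto_mapRange_sumFilter hf hK (tendsto_mapRange_sumFilter hf (isTail_hillFilter le_rfl _ _)
    (tendsto_mapRange_sumFilter hf hK (tendsto_mapRange_sumFilter hf
      (isTail_hillFilter le_rfl _ _) h h₁) h) h₂) h

theorem tendsto_neg_towerFilter : ∀ m,
    Tendsto (Finsupp.mapRange (fun z : ℤ => -z) neg_zero) (towerFilter m) (towerFilter m)
  | 0 => by simp [towerFilter]
  | m + 1 => by
    have hKt := isTail_towerFilter m
    have ih := tendsto_neg_towerFilter m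
    have htw (s : ℤ) := tendsto_mapRange_twinFilter (s := s) neg_zero hKt ih
      (tendsto_neg_hillFilter le_rfl (m + 1) s) (tendsto_neg_hillFilter le_rfl (m + 1) (-s))
    have h2 := htw (-1)
    rw [neg_neg] at h2
    -- Negation exchanges the two orders of the signs, which is why both occur in `stepFilter`.
    refine tendsto_mapRange_starFilter _ (hKt.stepFilter _) (tendsto_sup.2 ⟨?_, ?_⟩)
    · exact (htw 1).mono_right le_sup_right
    · exact h2.mono_right le_sup_left

theorem tendsto_tetris_towerFilter : ∀ m, Tendsto tetris (towerFilter (m + 1)) (towerFilter m)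
  | 0 => by
    refine tendsto_pure.2 ?_
    filter_upwards [eventually_abs_le_towerFilter 1] with u hu
    ext n
    have := abs_le.1 (hu n)
    rw [tetris_eq_mapRange, Finsupp.mapRange_apply, tetrisValue]
    push_cast at this
    split_ifs <;> simp <;> omega
  | m + 1 => by
    have hKt := isTail_towerFilter (m + 1)
    have ih := tendsto_tetris_towerFilter m
    have htw (s : ℤ) (hs : s = 1 ∨ s = -1) := tendsto_mapRange_twinFilter (s := s) (s' := s)
      (f := tetrisValue) (by simp [tetrisValue]) hKt ih
      (tendsto_tetris_hillFilter le_rfl (m + 1) hs)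
      (tendsto_tetris_hillFilter le_rfl (m + 1) (by omega))
    refine tendsto_mapRange_starFilter (by simp [tetrisValue]) (hKt.stepFilter _)
      (tendsto_sup.2 ⟨?_, ?_⟩)
    · exact (htw 1 (by simp)).mono_right le_sup_left
    · exact (htw (-1) (by simp)).mono_right le_sup_right

theorem tendsto_tetris_iterate_towerFilter (m j : ℕ) :
    Tendsto tetris^[j] (towerFilter (m + j)) (towerFilter m) := by
  induction j with
  | zero => exact tendsto_id
  | succ j ih =>
    rw [Function.iterate_succ]
    exact ih.comp (tendsto_tetris_towerFilter (m + j))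

end TowerFilter

/-! ### The Baire property under the tower quantifiers -/

section BaireQuantifier

variable {X : Type*} [TopologicalSpace X] {F G H : Filter FinSeq}

/-- The filter quantifier preserves the Baire property of parametrized families of sets. -/
def PreservesBaire (X : Type*) [TopologicalSpace X] (F : Filter FinSeq) : Prop :=
  ∀ S : FinSeq → Set X, (∀ u, BaireMeasurableSet (S u)) →
    BaireMeasurableSet {p | ∀ᶠ u in F, p ∈ S u}

theorem preservesBaire_pure (a : FinSeq) : PreservesBaire X (pure a) := fun S hS => by
  simpa using hS a

theorem PreservesBaire.sumFilter (hF : PreservesBaire X F) (hG : PreservesBaire X G) :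
    PreservesBaire X (F ⊹ G) := fun S hS =>
  hF (fun u => {p | ∀ᶠ v in G, p ∈ S (u + v)}) fun u => hG _ fun v => hS (u + v)

theorem PreservesBaire.sup (hF : PreservesBaire X F) (hG : PreservesBaire X G) :
    PreservesBaire X (F ⊔ G) := fun S hS => (hF S hS).inter (hG S hS)

theorem preservesBaire_pathFilter (vs : List ℤ) (t : ℕ) :
    PreservesBaire X (pathFilter atTop vs t) := by
  induction vs generalizing t with
  | nil => exact preservesBaire_pure 0
  | cons v vs ih =>
    intro S hS
    have : {p | ∀ᶠ u in pathFilter atTop (v :: vs) t, p ∈ S u} =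
        ⋃ N : ℕ, ⋂ e : ℕ, ⋂ _ : N ≤ e, {p | ∀ᶠ u in pathFilter atTop vs e,
          p ∈ S (seg v t e + u)} := by
      ext p
      simp only [mem_iUnion, mem_iInter]
      exact eventually_pathFilter_cons.trans eventually_atTop
    rw [this]
    exact .iUnion fun N => .iInter fun e => .iInter fun _ => ih e _ fun u => hS _

theorem PreservesBaire.starFilter [SecondCountableTopology X] (hH : PreservesBaire X H) :
    PreservesBaire X (starFilter H) := by
  intro S hS
  have hstay : ∀ u, BaireMeasurableSet {p | u ∈ OrderHom.gfp (stayOp H {u | p ∈ S u})} :=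
    BaireMeasurableSet.gfp (fun p => stayOp H {u | p ∈ S u}) fun V hV u =>
      (hS u).inter (hH (fun b => V (u + b)) fun b => hV (u + b))
  exact BaireMeasurableSet.lfp
    (fun p => reachOp H (OrderHom.gfp (stayOp H {u | p ∈ S u}))) (fun V hV u =>
      (hstay u).union (hH (fun b => V (u + b)) fun b => hV (u + b))) 0

theorem preservesBaire_towerFilter [SecondCountableTopology X] :
    ∀ m, PreservesBaire X (towerFilter m)
  | 0 => preservesBaire_pure 0
  | m + 1 => by
    have hK := preservesBaire_towerFilter m
    have h (s : ℤ) : PreservesBaire X (twinFilter (towerFilter m) (m + 1) s) :=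
      (((hK.sumFilter (preservesBaire_pathFilter _ _)).sumFilter hK).sumFilter
        (preservesBaire_pathFilter _ _)).sumFilter hK
    exact ((h 1).sup (h (-1))).starFilter

end BaireQuantifier

/-! ### Chains of idempotent ultrafilters -/

section CompactSemigroup

variable {M : Type*} [AddSemigroup M] [TopologicalSpace M] [T2Space M]

/-- A compact right-topological semigroup contains an idempotent whose local monoid is a group. -/
theorem exists_idempotent_with_inverses (hc : ∀ r : M, Continuous (· + r)) {S : Set M}
    (hne : S.Nonempty) (hS : IsCompact S) (hadd : ∀ x ∈ S, ∀ y ∈ S, x + y ∈ S) :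
    ∃ e ∈ S, e + e = e ∧ ∀ g ∈ S, ∃ w ∈ S, e + g + w = e := by
  let 𝓛 : Set (Set M) := {L | IsClosed L ∧ L.Nonempty ∧ L ⊆ S ∧ ∀ x ∈ S, ∀ y ∈ L, x + y ∈ L}
  have hS𝓛 : S ∈ 𝓛 := ⟨hS.isClosed, hne, subset_rfl, hadd⟩
  obtain ⟨L, hL⟩ : ∃ L, Minimal (· ∈ 𝓛) L := by
    refine zorn_superset 𝓛 fun c hc𝓛 hchain => ?_
    rcases c.eq_empty_or_nonempty with rfl | hcne
    · exact ⟨S, hS𝓛, by simp⟩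
    refine ⟨⋂₀ c, ⟨isClosed_sInter fun L hL => (hc𝓛 hL).1, ?_, ?_, ?_⟩,
      fun s hs => sInter_subset_of_mem hs⟩
    · have : Nonempty c := hcne.to_subtype
      rw [sInter_eq_iInter]
      refine IsCompact.nonempty_iInter_of_directed_nonempty_isCompact_isClosed _ ?_
        (fun i => (hc𝓛 i.2).2.1) (fun i => hS.of_isClosed_subset (hc𝓛 i.2).1 (hc𝓛 i.2).2.2.1)
        (fun i => (hc𝓛 i.2).1)
      exact directedOn_iff_directed.1 (IsChain.directedOn (hchain.symm))
    · obtain ⟨L, hL⟩ := hcne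
      exact (sInter_subset_of_mem hL).trans (hc𝓛 hL).2.2.1
    · exact fun x hx y hy L hL => (hc𝓛 hL).2.2.2 x hx y (hy L hL)
  have hLS := hL.prop.2.2.1
  -- By minimality S + v is all of L. Hence every element of e + S + e has a left inverse there,
  -- which makes this monoid a group.
  have hmin : ∀ v ∈ L, ∀ y ∈ L, ∃ x ∈ S, x + v = y := by
    intro v hv
    have h1 : (· + v) '' S ∈ 𝓛 := by
      refine ⟨(hS.image (hc v)).isClosed, hne.image _, ?_, ?_⟩
      · rintro _ ⟨x, hx, rfl⟩; exact hadd x hx v (hLS hv)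
      · rintro x hx _ ⟨y, hy, rfl⟩; exact ⟨x + y, hadd x hx y hy, add_assoc _ _ _⟩
    have h2 : (· + v) '' S ⊆ L := by
      rintro _ ⟨x, hx, rfl⟩; exact hL.prop.2.2.2 x hx v hv
    exact fun y hy => hL.le_of_le h1 h2 hy
  obtain ⟨e, heL, hee⟩ := exists_idempotent_in_compact_add_subsemigroup hc L hL.prop.2.1
    (hS.of_isClosed_subset hL.prop.1 hLS) fun x hx y hy => hL.prop.2.2.2 x (hLS hx) y hy
  have heS := hLS heL
  have hleft : ∀ a ∈ S, ∃ b ∈ S, e + b + e + (e + a + e) = e := by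
    intro a ha
    obtain ⟨b, hb, hba⟩ := hmin (e + a + e) (hL.prop.2.2.2 _ (hadd e heS a ha) e heL) e heL
    refine ⟨b, hb, ?_⟩
    have : e + b + e + (e + a + e) = e + (b + (e + e + a + e)) := by
      simp only [add_assoc]
    rw [this, hee, hba, hee]
  refine ⟨e, heS, hee, fun g hg => ?_⟩
  obtain ⟨b, hb, hbg⟩ := hleft g hg
  obtain ⟨d, -, hdb⟩ := hleft b hb
  have hd : e + d + e = e + g + e := by
    calc e + d + e = e + d + e + e := by rw [add_assoc (e + d) e e, hee]
      _ = e + d + e + (e + b + e + (e + g + e)) := by rw [hbg]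
      _ = e + (e + g + e) := by rw [← add_assoc, hdb]
      _ = e + g + e := by rw [← add_assoc, ← add_assoc, hee]
  refine ⟨e + (e + b + e), hadd _ heS _ (hadd _ (hadd _ heS _ hb) _ heS), ?_⟩
  rw [← add_assoc, ← hd, hdb]

end CompactSemigroup

/-! ### Ultrafilters shadowing the tower -/

section Chain

attribute [local instance] Ultrafilter.add Ultrafilter.addSemigroup

variable {F G H K : Filter FinSeq} {x y e X : Ultrafilter FinSeq} {l m M : ℕ}

theorem Ultrafilter.coe_add (x y : Ultrafilter FinSeq) :
    ((x + y : Ultrafilter FinSeq) : Filter FinSeq) = (x : Filter FinSeq) ⊹ y := by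
  ext D
  exact Ultrafilter.eventually_add x y (· ∈ D)

theorem isClosed_setOf_isTail : IsClosed {x : Ultrafilter FinSeq | IsTail x} := by
  have : {x : Ultrafilter FinSeq | IsTail x} = ⋂ N, {x | {u | SuppFrom N u} ∈ x} := by
    ext x; simp only [mem_iInter]; rfl
  rw [this]
  exact isClosed_iInter fun N => ultrafilter_isClosed_basic _

theorem isClosed_setOf_shadows (F : Filter FinSeq) :
    IsClosed {x : Ultrafilter FinSeq | Shadows x F} := by
  have : {x : Ultrafilter FinSeq | Shadows x F} =
      ⋂ (A : Set FinSeq) (_ : ¬ ∀ᶠ b in F, ∃ a ∈ A, Near a b), {x | A ∈ x}ᶜ := by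
    ext x
    simp only [mem_iInter, mem_compl_iff, Shadows]
    exact ⟨fun h A hA hx => hA (h A hx), fun h A hA => by
      by_contra h'
      exact h A h' hA⟩
  rw [this]
  exact isClosed_iInter fun A => isClosed_iInter fun _ => (ultrafilter_isOpen_basic A).isClosed_compl

/-- Generic hills along a fixed nonprincipal ultrafilter. -/
noncomputable def hillUltrafilter (m : ℕ) (s : ℤ) : Ultrafilter FinSeq :=
  (exists_ultrafilter_eq_pathFilter (hyperfilter ℕ) ((hill m).map (s * ·)) 0).choose

theorem coe_hillUltrafilter (m : ℕ) (s : ℤ) :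
    (hillUltrafilter m s : Filter FinSeq) = hillFilter (hyperfilter ℕ) m s :=
  (exists_ultrafilter_eq_pathFilter (hyperfilter ℕ) ((hill m).map (s * ·)) 0).choose_spec

theorem hyperfilter_le_atTop : (hyperfilter ℕ : Filter ℕ) ≤ atTop := Nat.hyperfilter_le_atTop

theorem isTail_hillUltrafilter (m : ℕ) (s : ℤ) : IsTail (hillUltrafilter m s) := by
  rw [coe_hillUltrafilter]; exact isTail_hillFilter hyperfilter_le_atTop m s

theorem shadows_hillUltrafilter (h : l = m ∨ l = m + 1 ∨ m = l + 1) {s : ℤ}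
    (hs : s = 1 ∨ s = -1) : Shadows (hillUltrafilter l s) (hillFilter atTop m s) := by
  rw [coe_hillUltrafilter]
  exact shadows_hillFilter hyperfilter_le_atTop h (by rcases hs with rfl | rfl <;> simp)

theorem Shadows.add (h : Shadows x F) (h' : Shadows y G) (hy : IsTail y) (hG : IsTail G) :
    Shadows (x + y : Ultrafilter FinSeq) (F ⊹ G) := by
  rw [Ultrafilter.coe_add]; exact h.sumFilter h' hy hG

theorem IsTail.add (hx : IsTail x) (hy : IsTail y) : IsTail (x + y : Ultrafilter FinSeq) := by
  rw [Ultrafilter.coe_add]; exact hx.sumFilter hy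

theorem abs_le_add_ultrafilter (hx : ∀ᶠ u in (x : Filter FinSeq), ∀ n, |u n| ≤ (m : ℤ))
    (hy : ∀ᶠ u in (y : Filter FinSeq), ∀ n, |u n| ≤ (m : ℤ)) (hyt : IsTail y) :
    ∀ᶠ u in ((x + y : Ultrafilter FinSeq) : Filter FinSeq), ∀ n, |u n| ≤ (m : ℤ) := by
  rw [Ultrafilter.coe_add]
  exact eventually_abs_le_sumFilter hx hy hyt

/-- Data recording that hills of height `l` of both signs can be absorbed by `e`. -/
def HillAbsorbing (l : ℕ) (K : Filter FinSeq) (e : Ultrafilter FinSeq) : Prop :=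
  ∀ s : ℤ, s = 1 ∨ s = -1 → ∃ ρ : Ultrafilter FinSeq, IsTail ρ ∧ Shadows ρ K ∧ ρ + e = ρ ∧
    e + hillUltrafilter l s + ρ = e

/-- Shadows of twin hills, with possibly different hills on the ultrafilter side. -/
theorem shadows_twinFilter {K : Filter FinSeq} {l l' m : ℕ} (hl : l = m ∨ l = m + 1 ∨ m = l + 1)
    (hl' : l' = m ∨ l' = m + 1 ∨ m = l' + 1) {s : ℤ} (hs : s = 1 ∨ s = -1)
    {ρ ρ' : Ultrafilter FinSeq} (hK : IsTail K) (hx : Shadows x K) (hρ : Shadows ρ K)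
    (hρ' : Shadows ρ' K) (hρt : IsTail ρ) (hρt' : IsTail ρ')
    (h : x + hillUltrafilter l s + ρ + hillUltrafilter l' (-s) + ρ' = y) :
    Shadows y (twinFilter K m s) := by
  rw [← h]
  exact ((((hx.add (shadows_hillUltrafilter hl hs) (isTail_hillUltrafilter _ _)
    (isTail_hillFilter le_rfl _ _)).add hρ hρt hK).add
    (shadows_hillUltrafilter hl' (by omega)) (isTail_hillUltrafilter _ _)
    (isTail_hillFilter le_rfl _ _)).add hρ' hρt' hK)

/-- Because x = x + e and e absorbs hills of both signs, x can be rewritten as x + hill + ρ +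
opposite hill + ρ', in either order of the signs. -/
theorem Shadows.stepFilter_of_absorbing (hl : l = m ∨ l = m + 1 ∨ m = l + 1) (hK : IsTail K)
    (he : HillAbsorbing l K e) (hxe : x + e = x) (hx : Shadows x K) :
    Shadows x (stepFilter K m) := by
  have key : ∀ s : ℤ, s = 1 ∨ s = -1 → Shadows x (twinFilter K m s) := by
    intro s hs
    obtain ⟨ρ, hρt, hρ, hρe, heρ⟩ := he s hs
    obtain ⟨ρ', hρt', hρ', -, heρ'⟩ := he (-s) (by omega)
    refine shadows_twinFilter hl hl hs hK hx hρ hρ' hρt hρt' ?_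
    calc x + hillUltrafilter l s + ρ + hillUltrafilter l (-s) + ρ'
        = x + e + hillUltrafilter l s + (ρ + e) + hillUltrafilter l (-s) + ρ' := by rw [hxe, hρe]
      _ = x + ((e + hillUltrafilter l s + ρ) + (e + hillUltrafilter l (-s) + ρ')) := by
          simp only [add_assoc]
      _ = x := by rw [heρ, heρ', ← add_assoc, hxe, hxe]
  exact (key 1 (by simp)).sup (key (-1) (by simp))

theorem Shadows.starFilter_ultrafilter (hee : e + e = e) (he : IsTail e) (heH : Shadows e H)
    (hH : IsTail H) (hxe : x + e = x) (hx : Shadows x H) : Shadows x (_root_.starFilter H) :=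
  Shadows.starFilter (e := e) (by rw [← Ultrafilter.coe_add, hee]) he heH hH
    (by rw [← Ultrafilter.coe_add, hxe]) hx

theorem Shadows.towerFilter_succ_of_absorbing (hl : l = m + 1 ∨ l = m + 1 + 1 ∨ m + 1 = l + 1)
    (he : HillAbsorbing l (towerFilter m) e) (hee : e + e = e) (het : IsTail e)
    (hem : Shadows e (towerFilter m)) (hxe : x + e = x) (hx : Shadows x (towerFilter m)) :
    Shadows x (towerFilter (m + 1)) :=
  Shadows.starFilter_ultrafilter hee het
    (Shadows.stepFilter_of_absorbing hl (isTail_towerFilter m) he hee hem)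
    ((isTail_towerFilter m).stepFilter _) hxe
    (Shadows.stepFilter_of_absorbing hl (isTail_towerFilter m) he hxe hx)

theorem shadows_towerFilter_add (hx : Shadows x (towerFilter m)) (hy : Shadows y (towerFilter m))
    (hyt : IsTail y) : Shadows (x + y : Ultrafilter FinSeq) (towerFilter m) :=
  (hx.add hy hyt (isTail_towerFilter m)).mono (towerFilter_le_sumFilter m)

/-- The step of the construction of chains. -/
theorem exists_hillAbsorbing_idempotent (hXt : IsTail X) (hXX : X + X = X)
    (hXb : ∀ᶠ u in (X : Filter FinSeq), ∀ n, |u n| ≤ ((M + 1 : ℕ) : ℤ))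
    (hX : Shadows X (towerFilter M))
    (hz : ∀ s : ℤ, s = 1 ∨ s = -1 →
      Shadows (X + hillUltrafilter (M + 1) s + X : Ultrafilter FinSeq) (towerFilter M)) :
    ∃ e : Ultrafilter FinSeq, IsTail e ∧ e + e = e ∧ X + e = e ∧ e + X = e ∧
      (∀ᶠ u in (e : Filter FinSeq), ∀ n, |u n| ≤ ((M + 1 : ℕ) : ℤ)) ∧
      Shadows e (towerFilter (M + 1)) ∧ Shadows e (towerFilter (M + 2)) ∧
      HillAbsorbing (M + 1) (towerFilter (M + 1)) e := by
  -- Only `(· + r)` is known to be continuous, so x + X = x can be imposed as a closed condition,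
  -- while X + x = x must be arranged afterwards.
  let S : Set (Ultrafilter FinSeq) := {x | IsTail x} ∩ {x | Shadows x (towerFilter M)} ∩
    {x | {u | ∀ n, |u n| ≤ ((M + 1 : ℕ) : ℤ)} ∈ x} ∩ {x | x + X = x}
  have hcont : ∀ r : Ultrafilter FinSeq, Continuous (· + r) := Ultrafilter.continuous_add_left
  have hSc : IsClosed S := ((isClosed_setOf_isTail.inter (isClosed_setOf_shadows _)).inter
    (ultrafilter_isClosed_basic _)).inter (isClosed_eq (hcont X) continuous_id)
  have hSadd : ∀ x ∈ S, ∀ y ∈ S, x + y ∈ S := by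
    rintro x ⟨⟨⟨hx1, hx2⟩, hx3⟩, hx4⟩ y ⟨⟨⟨hy1, hy2⟩, hy3⟩, hy4⟩
    exact ⟨⟨⟨IsTail.add hx1 hy1, shadows_towerFilter_add hx2 hy2 hy1⟩,
      abs_le_add_ultrafilter hx3 hy3 hy1⟩, by
        change x + y + X = x + y
        rw [add_assoc, show y + X = y from hy4]⟩
  have hXS : X ∈ S := ⟨⟨⟨hXt, hX⟩, hXb⟩, hXX⟩
  have hzS : ∀ s : ℤ, s = 1 ∨ s = -1 → X + hillUltrafilter (M + 1) s + X ∈ S := by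
    intro s hs
    refine ⟨⟨⟨(hXt.add (isTail_hillUltrafilter _ _)).add hXt, hz s hs⟩,
      abs_le_add_ultrafilter (abs_le_add_ultrafilter hXb ?_ (isTail_hillUltrafilter _ _)) hXb hXt⟩,
      ?_⟩
    · rw [coe_hillUltrafilter]
      exact abs_le_hillFilter hyperfilter_le_atTop _ (by rcases hs with rfl | rfl <;> simp)
    · change _ + X = _
      rw [add_assoc _ X X, hXX]
  obtain ⟨e', he'S, hee', hinv⟩ :=
    exists_idempotent_with_inverses hcont ⟨X, hXS⟩ hSc.isCompact hSadd
  have he'X : e' + X = e' := he'S.2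
  -- Passing to X + e' makes the idempotent absorb X on the left as well.
  have heS : X + e' ∈ S := hSadd _ hXS _ he'S
  have hXe : X + (X + e') = X + e' := by rw [← add_assoc, hXX]
  have heX : X + e' + X = X + e' := heS.2
  have hee : X + e' + (X + e') = X + e' := by rw [← add_assoc, heX, add_assoc, hee']
  have habs : ∀ s : ℤ, s = 1 ∨ s = -1 → ∃ ρ ∈ S, ρ + (X + e') = ρ ∧
      X + e' + hillUltrafilter (M + 1) s + ρ = X + e' := by
    intro s hs
    obtain ⟨w, hw, hwe⟩ := hinv _ (hzS s hs)
    refine ⟨X + w + (X + e'), hSadd _ (hSadd _ hXS _ hw) _ heS, by rw [add_assoc, hee], ?_⟩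
    calc X + e' + hillUltrafilter (M + 1) s + (X + w + (X + e'))
        = X + (e' + X) + hillUltrafilter (M + 1) s + (X + w + (X + e')) := by rw [he'X]
      _ = X + (e' + (X + hillUltrafilter (M + 1) s + X) + w) + (X + e') := by
          simp only [add_assoc]
      _ = X + e' := by rw [hwe, hee]
  generalize X + e' = e at *
  obtain ⟨⟨⟨het, heM⟩, heb⟩, -⟩ := heS
  have habsM : HillAbsorbing (M + 1) (towerFilter M) e := by
    intro s hs
    obtain ⟨ρ, hρ, h1, h2⟩ := habs s hs
    exact ⟨ρ, hρ.1.1.1, hρ.1.1.2, h1, h2⟩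
  -- This lifts the remainders ρ one level together with e, so absorption can be used again, now
  -- with hills of height M + 1 standing for those of height M + 2.
  have hup : ∀ x ∈ S, x + e = x → Shadows x (towerFilter (M + 1)) := fun x hx hxe =>
    Shadows.towerFilter_succ_of_absorbing (Or.inl rfl) habsM hee het heM hxe hx.1.1.2
  have he1 := Shadows.towerFilter_succ_of_absorbing (Or.inl rfl) habsM hee het heM hee heM
  have habsM' : HillAbsorbing (M + 1) (towerFilter (M + 1)) e := by
    intro s hs
    obtain ⟨ρ, hρ, h1, h2⟩ := habs s hs
    exact ⟨ρ, hρ.1.1.1, hup ρ hρ h1, h1, h2⟩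
  exact ⟨e, het, hee, hXe, heX, heb, he1,
    Shadows.towerFilter_succ_of_absorbing (by simp) habsM' hee het he1 hee he1, habsM'⟩

/-- A chain of idempotent ultrafilters shadowing the tower of filters. -/
structure TowerChain (l : ℕ) (Ξ : ℕ → Ultrafilter FinSeq) : Prop where
  isTail : ∀ i, IsTail (Ξ i)
  add : ∀ i j, Ξ i + Ξ j = Ξ (min i j)
  shadows : ∀ j, Shadows (Ξ j) (towerFilter (l - j))
  shadows_succ : Shadows (Ξ 0) (towerFilter (l + 1))
  abs_le : ∀ᶠ u in (Ξ 0 : Filter FinSeq), ∀ n, |u n| ≤ (l : ℤ)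
  absorbing : HillAbsorbing l (towerFilter l) (Ξ 0)

/-- `Ξ 0` serves both level l + 1 and level l of the new chain, and only the top idempotent is new.
-/
theorem TowerChain.extend {Ξ : ℕ → Ultrafilter FinSeq} (h : TowerChain l Ξ) :
    ∃ Ξ', TowerChain (l + 2) Ξ' := by
  have h00 : Ξ 0 + Ξ 0 = Ξ 0 := h.add 0 0
  have h0s : Shadows (Ξ 0) (towerFilter l) := h.shadows 0
  have hstep : Shadows (Ξ 0) (stepFilter (towerFilter l) (l + 1)) :=
    Shadows.stepFilter_of_absorbing (by simp) (isTail_towerFilter l) h.absorbing h00 h0s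
  obtain ⟨e, het, hee, hXe, heX, heb, he1, he2, habs⟩ := exists_hillAbsorbing_idempotent
    (M := l + 1) (h.isTail 0) h00 (h.abs_le.mono fun u hu n => (hu n).trans (by push_cast; linarith))
    h.shadows_succ fun s hs => by
      obtain ⟨ρ, hρt, hρ, hρe, heρ⟩ := h.absorbing (-s) (by omega)
      -- The visible hill has height l + 2; its partner of sign -s and height l is unfolded from the
      -- right copy of `Ξ 0` here and from the left copy in `htw'`. Both heights are within one of l
      -- + 1.
      have htw : Shadows (Ξ 0 + hillUltrafilter (l + 1 + 1) s + Ξ 0 : Ultrafilter FinSeq)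
          (twinFilter (towerFilter l) (l + 1) s) :=
        shadows_twinFilter (x := Ξ 0) (ρ := Ξ 0) (ρ' := ρ) (l := l + 1 + 1) (l' := l) (by simp)
          (by simp) hs (isTail_towerFilter l) h0s h0s hρ (h.isTail 0) hρt (by
            simp only [add_assoc] at heρ ⊢
            rw [heρ])
      have htw' : Shadows (Ξ 0 + hillUltrafilter (l + 1 + 1) s + Ξ 0 : Ultrafilter FinSeq)
          (twinFilter (towerFilter l) (l + 1) (-s)) :=
        shadows_twinFilter (x := Ξ 0) (ρ := ρ) (ρ' := Ξ 0) (l := l) (l' := l + 1 + 1) (by simp)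
          (by simp) (by omega) (isTail_towerFilter l) h0s hρ h0s hρt (h.isTail 0) (by
            rw [heρ, neg_neg])
      refine Shadows.starFilter_ultrafilter h00 (h.isTail 0) hstep
        ((isTail_towerFilter l).stepFilter _) (by rw [add_assoc, h00]) ?_
      rcases hs with rfl | rfl
      · exact htw.sup htw'
      · rw [neg_neg] at htw'
        exact htw'.sup htw
  have heΞ : ∀ j, e + Ξ j = e := fun j => by
    rw [← heX, add_assoc, h.add, Nat.zero_min]
  have hΞe : ∀ j, Ξ j + e = e := fun j => by
    rw [← hXe, ← add_assoc, h.add, Nat.min_zero]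
  refine ⟨fun | 0 => e | 1 => Ξ 0 | j + 2 => Ξ j, ?_, ?_, ?_, he2, heb, habs⟩
  · rintro (_ | _ | i)
    exacts [het, h.isTail 0, h.isTail i]
  · rintro (_ | _ | i) (_ | _ | j)
    · exact hee
    · exact heX
    · exact heΞ j
    · exact hXe
    · exact h00
    · simpa using h.add 0 j
    · exact hΞe i
    · simpa using h.add i 0
    · simpa using h.add i j
  · rintro (_ | _ | j)
    · exact he1
    · exact h.shadows_succ
    · simpa using h.shadows j

theorem pure_zero_add (x : Ultrafilter FinSeq) : pure 0 + x = x := by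
  apply Ultrafilter.coe_injective
  rw [Ultrafilter.coe_add]
  exact pure_zero_sumFilter

theorem add_pure_zero (x : Ultrafilter FinSeq) : x + pure 0 = x := by
  apply Ultrafilter.coe_injective
  rw [Ultrafilter.coe_add]
  exact sumFilter_pure_zero

theorem hillAbsorbing_pure_zero : HillAbsorbing 0 (pure 0) (pure 0) := fun s hs =>
  ⟨pure 0, isTail_pure_zero, shadows_pure_zero, pure_zero_add _, by
    rw [add_pure_zero, pure_zero_add]
    apply Ultrafilter.coe_injective
    rw [coe_hillUltrafilter]
    rfl⟩

theorem towerChain_zero : TowerChain 0 fun _ => pure 0 where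
  isTail _ := isTail_pure_zero
  add _ _ := pure_zero_add _
  shadows j := by
    rw [Nat.zero_sub]
    exact shadows_pure_zero
  shadows_succ := Shadows.towerFilter_succ_of_absorbing (e := pure 0) (l := 0) (by simp)
    hillAbsorbing_pure_zero (pure_zero_add _) isTail_pure_zero shadows_pure_zero (pure_zero_add _)
    shadows_pure_zero
  abs_le := fun n => by simp
  absorbing := hillAbsorbing_pure_zero

theorem exists_towerChain_one : ∃ Ξ, TowerChain 1 Ξ := by
  obtain ⟨e, het, hee, hXe, heX, heb, he1, he2, habs⟩ := exists_hillAbsorbing_idempotent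
    (X := pure 0) (M := 0) isTail_pure_zero (pure_zero_add _) (fun n => by simp) shadows_pure_zero
    fun s hs => by
      rw [add_pure_zero, pure_zero_add]
      exact shadows_hillUltrafilter (m := 0) (by simp) hs
  refine ⟨fun | 0 => e | _ + 1 => pure 0, ?_, ?_, ?_, he2, heb, habs⟩
  · rintro (_ | i)
    exacts [het, isTail_pure_zero]
  · rintro (_ | i) (_ | j)
    · exact hee
    · exact heX
    · exact hXe
    · have : min (i + 1) (j + 1) = min i j + 1 := by omega
      rw [this]
      exact pure_zero_add _
  · rintro (_ | j)
    · exact he1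
    · have : 1 - (j + 1) = 0 := by omega
      rw [this]
      exact shadows_pure_zero

theorem exists_towerChain : ∀ l, ∃ Ξ, TowerChain l Ξ
  | 0 => ⟨_, towerChain_zero⟩
  | 1 => exists_towerChain_one
  | l + 2 => by
    obtain ⟨Ξ, h⟩ := exists_towerChain l
    exact h.extend

theorem TowerChain.exists_abs_eq {Ξ : ℕ → Ultrafilter FinSeq} (h : TowerChain (m + 1) Ξ) :
    ∀ᶠ u in (Ξ 0 : Filter FinSeq), ∃ n, |u n| = ((m + 1 : ℕ) : ℤ) := by
  obtain ⟨ρ, hρt, -, -, heρ⟩ := h.absorbing 1 (by simp)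
  rw [← heρ, Ultrafilter.coe_add, Ultrafilter.coe_add, coe_hillUltrafilter]
  exact eventually_exists_abs_sumFilter (eventually_exists_abs_sumFilter'
    (exists_abs_eq_hillFilter hyperfilter_le_atTop _ (by simp)) (by omega)
    (isTail_hillFilter hyperfilter_le_atTop _ _)) (by omega) hρt

end Chain

/-! ### States: finite approximations of the required block sequence -/

section States

attribute [local instance] Ultrafilter.add Ultrafilter.addSemigroup

/-- A letter `(ε, j)` stands for the operation `ε T^j`. -/
abbrev Letter (k : ℕ) := ℤˣ × Fin k

/-- A state is a finite list of blocks, the latest one first; each block provides a sequence for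
every letter. -/
abbrev State (k : ℕ) := List (Letter k → FinSeq)

variable {k : ℕ}

/-- The sums of a state using at most one letter for each block, with a flag telling whether a
letter `(ε, 0)` was used. -/
noncomputable def stateSums : State k → Set (Bool × FinSeq)
  | [] => {(false, 0)}
  | α :: σ => stateSums σ ∪
      ⋃ x : Letter k, (fun q => (q.1 || decide (x.2.val = 0), q.2 + α x)) '' stateSums σ

theorem finite_stateSums : ∀ σ : State k, (stateSums σ).Finite
  | [] => finite_singleton _
  | _ :: σ => (finite_stateSums σ).union (finite_iUnion fun _ => (finite_stateSums σ).image _)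

/-- A state is good for `A` when its sums can be continued within `A` along the ultrafilters. -/
def IsGoodState (Ξ : ℕ → Ultrafilter FinSeq) (A : Set FinSeq) (σ : State k) : Prop :=
  ∀ q ∈ stateSums σ, {v | q.2 + v ∈ A} ∈ Ξ 0 ∧
    (q.1 = true → q.2 ∈ A ∧ ∀ i < k, {v | q.2 + v ∈ A} ∈ Ξ i)

theorem TowerChain.eventually_mem {l : ℕ} {Ξ : ℕ → Ultrafilter FinSeq} (hΞ : TowerChain l Ξ)
    {i j : ℕ} {A : Set FinSeq} {u : FinSeq} (h : {v | u + v ∈ A} ∈ Ξ (min i j)) :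
    ∀ᶠ a in (Ξ i : Filter FinSeq), {v | u + a + v ∈ A} ∈ Ξ j := by
  rw [← hΞ.add i j, ← Ultrafilter.mem_coe, Ultrafilter.coe_add, mem_sumFilter] at h
  simp only [add_assoc]
  exact h

/-- A set large for `Ξ (min i j)` is large for `Ξ i + Ξ j`. Once a letter with j = 0 has occurred,
the sum has type `Ξ 0`, and adding any `Ξ i` does not change it; before that, only continuation by
`Ξ 0` can be guaranteed. -/
theorem TowerChain.eventually_isGoodState {Ξ : ℕ → Ultrafilter FinSeq} (hΞ : TowerChain k Ξ)
    {A : Set FinSeq} {σ : State k} (hσ : IsGoodState Ξ A σ) (x : Letter k) :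
    ∀ᶠ a in (Ξ x.2 : Filter FinSeq), ∀ q ∈ stateSums σ, {v | q.2 + a + v ∈ A} ∈ Ξ 0 ∧
      (q.1 = true ∨ x.2.val = 0 → q.2 + a ∈ A ∧ ∀ i < k, {v | q.2 + a + v ∈ A} ∈ Ξ i) := by
  rw [eventually_all_finite (finite_stateSums σ)]
  intro q hq
  obtain ⟨h0, h1⟩ := hσ q hq
  have hfin : ∀ (i : ℕ), (∀ l < k, {v | q.2 + v ∈ A} ∈ Ξ (min i l)) → i < k →
      ∀ᶠ a in (Ξ i : Filter FinSeq),
        q.2 + a ∈ A ∧ ∀ l < k, {v | q.2 + a + v ∈ A} ∈ Ξ l := by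
    intro i hi hik
    have hii := hi i hik
    rw [min_self] at hii
    have := (eventually_all_finite (finite_lt_nat k)).2 fun l hl => hΞ.eventually_mem (hi l hl)
    filter_upwards [hii, this] with a ha ha' using ⟨ha, ha'⟩
  have hstep := hΞ.eventually_mem (i := x.2) (j := 0) (A := A) (u := q.2) (by
    rw [Nat.min_zero]; exact h0)
  by_cases hf : q.1 = true
  · filter_upwards [hstep, hfin x.2 (fun l hl => (h1 hf).2 _ (by omega)) x.2.isLt] with a ha ha'
      using ⟨ha, fun _ => ha'⟩
  by_cases hx : x.2.val = 0
  · filter_upwards [hstep, hfin x.2 (fun l hl => by rw [hx, Nat.zero_min]; exact h0) x.2.isLt]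
      with a ha ha' using ⟨ha, fun _ => ha'⟩
  · filter_upwards [hstep] with a ha using ⟨ha, fun h => (h.elim hf hx).elim⟩

theorem isGoodState_cons {Ξ : ℕ → Ultrafilter FinSeq} {A : Set FinSeq} {σ : State k}
    (hσ : IsGoodState Ξ A σ) {α : Letter k → FinSeq}
    (hα : ∀ x : Letter k, ∀ q ∈ stateSums σ, {v | q.2 + α x + v ∈ A} ∈ Ξ 0 ∧
      (q.1 = true ∨ x.2.val = 0 → q.2 + α x ∈ A ∧ ∀ i < k, {v | q.2 + α x + v ∈ A} ∈ Ξ i)) :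
    IsGoodState Ξ A (α :: σ) := by
  rintro q (hq | hq)
  · exact hσ q hq
  · obtain ⟨x, q, hq', rfl⟩ := mem_iUnion.1 hq
    obtain ⟨h0, h1⟩ := hα x q hq'
    exact ⟨h0, fun h => h1 (by simpa using h)⟩

/-- The operation `ε T^j` named by a letter. -/
noncomputable def Letter.act (x : Letter k) (b : FinSeq) : FinSeq :=
  (x.1 : ℤ) • tetris^[x.2] b

theorem Letter.tendsto_act (x : Letter k) :
    Tendsto x.act (towerFilter k) (towerFilter (k - x.2)) := by
  have h1 := tendsto_tetris_iterate_towerFilter (k - x.2) x.2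
  rw [Nat.sub_add_cancel x.2.isLt.le] at h1
  rcases Int.units_eq_one_or x.1 with h | h
  · have : x.act = tetris^[x.2] := by funext b; simp [Letter.act, h]
    rwa [this]
  · have : x.act = Finsupp.mapRange (fun z : ℤ => -z) neg_zero ∘ tetris^[x.2] := by
      funext b; ext n; simp [Letter.act, h]
    rw [this]
    exact (tendsto_neg_towerFilter _).comp h1

/-- Every letter of the block `α` is near the corresponding image of `b`. -/
def BlockNear (N : ℕ) (α : Letter k → FinSeq) (b : FinSeq) : Prop :=
  ∀ x : Letter k, SuppFrom N (α x) ∧ Near (α x) (x.act b)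

/-- If b is generic at level k, then `ε T^j b` is generic at level k - j for both signs, hence near
a member of the required `Ξ j`-large set. There are only finitely many letters. -/
theorem TowerChain.eventually_exists_cons {Ξ : ℕ → Ultrafilter FinSeq} (hΞ : TowerChain k Ξ)
    {A : Set FinSeq} {σ : State k} (hσ : IsGoodState Ξ A σ) (N : ℕ) :
    ∀ᶠ b in towerFilter k, ∃ α, BlockNear N α b ∧ IsGoodState Ξ A (α :: σ) := by
  have hall : ∀ᶠ b in towerFilter k, ∀ x : Letter k, ∃ a, (SuppFrom N a ∧
      ∀ q ∈ stateSums σ, {v | q.2 + a + v ∈ A} ∈ Ξ 0 ∧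
      (q.1 = true ∨ x.2.val = 0 → q.2 + a ∈ A ∧ ∀ i < k, {v | q.2 + a + v ∈ A} ∈ Ξ i)) ∧
      Near a (x.act b) := by
    rw [eventually_all]
    intro x
    exact x.tendsto_act.eventually (hΞ.shadows x.2 _
      (((hΞ.isTail x.2) N).and (hΞ.eventually_isGoodState hσ x)))
  filter_upwards [hall] with b hb
  choose α hα hαb using hb
  exact ⟨α, fun x => ⟨(hα x).1, hαb x⟩, isGoodState_cons hσ fun x => (hα x).2⟩

theorem FinPM.toFinsupp_injective : Function.Injective (FinPM.toFinsupp (k := k)) := by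
  rintro ⟨a, _, _⟩ ⟨b, _, _⟩ rfl
  rfl

instance FinPM.instCountable : Countable (FinPM k) := FinPM.toFinsupp_injective.countable

variable {X : Type*}

/-- The underlying sequences of the elements of colour `j` in the colouring at `p`. -/
def colourClass {n : ℕ} (c : FinPM k × X → Fin n) (j : Fin n) (p : X) : Set FinSeq :=
  {a | ∃ h : FinPM k, h.toFinsupp = a ∧ c (h, p) = j}

variable [TopologicalSpace X]

theorem baireMeasurableSet_colourClass [SecondCountableTopology X] {n : ℕ}
    {c : FinPM k × X → Fin n} {j : Fin n} (hc : SouslinMeasurable (c ⁻¹' {j})) (a : FinSeq) :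
    BaireMeasurableSet {p | a ∈ colourClass c j p} := by
  have : {p | a ∈ colourClass c j p} =
      ⋃ (h : FinPM k) (_ : h.toFinsupp = a), (fun p => (h, p)) ⁻¹' (c ⁻¹' {j}) := by
    ext p
    simp only [colourClass, mem_iUnion, exists_prop]
    rfl
  rw [this]
  exact .iUnion fun h => .iUnion fun _ =>
    hc.baireMeasurableSet_preimage (Continuous.prodMk_right h)

/-- Open sets of parameters attached to the states, along which generic parameters allow blocks
to be appended forever. -/
theorem exists_open_state_system [SecondCountableTopology X] [BaireSpace X] [Nonempty X]
    (hk : 1 ≤ k) {n : ℕ} (c : FinPM k × X → Fin n) (hc : ∀ j, SouslinMeasurable (c ⁻¹' {j})) :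
    ∃ (j : Fin n) (Z : State k → Set X), (∀ σ, IsOpen (Z σ)) ∧ (Z []).Nonempty ∧
      ∀ᶠ p in residual X, ∀ σ, p ∈ Z σ → (∀ u, (true, u) ∈ stateSums σ → u ∈ colourClass c j p) ∧
        ∀ N, ∀ᶠ b in towerFilter k, ∃ α, BlockNear N α b ∧ p ∈ Z (α :: σ) := by
  obtain ⟨Ξ, hΞ⟩ := exists_towerChain k
  let E : Fin n → State k → Set X := fun j σ => {p | IsGoodState Ξ (colourClass c j p) σ}
  choose Z hZo hEZ hZB using fun j σ => exists_open_hull (E j σ)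
  -- `Ξ 0` concentrates on sequences of `FinPM k`, so one of the finitely many colour classes
  -- belongs to it.
  have hcover : ∀ p, ∃ j, p ∈ E j [] := by
    intro p
    have h1 : ∀ᶠ a in (Ξ 0 : Filter FinSeq), ∃ j, a ∈ colourClass c j p := by
      obtain ⟨m, rfl⟩ : ∃ m, k = m + 1 := ⟨k - 1, by omega⟩
      filter_upwards [hΞ.abs_le, hΞ.exists_abs_eq] with a ha ha'
      exact ⟨_, ⟨a, ha, ha'⟩, rfl, rfl⟩
    obtain ⟨j, hj⟩ := Ultrafilter.eventually_exists_iff.1 h1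
    refine ⟨j, ?_⟩
    rintro q rfl
    refine ⟨by simpa using hj, by simp⟩
  have hne : ∃ j, (Z j []).Nonempty := by
    obtain ⟨p, hp⟩ := (dense_of_mem_residual (eventually_all.2 fun j => hEZ j [])).nonempty
    obtain ⟨j, hj⟩ := hcover p
    exact ⟨j, p, hp j hj⟩
  obtain ⟨j, hj⟩ := hne
  refine ⟨j, Z j, hZo j, hj, ?_⟩
  have hEZ' : ∀ᶠ p in residual X, ∀ σ, p ∈ E j σ → p ∈ Z j σ :=
    eventually_countable_forall.2 fun σ => hEZ j σ
  rw [eventually_countable_forall]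
  intro σ
  have hcol : ∀ᶠ p in residual X, ∀ u : FinSeq, (true, u) ∈ stateSums σ → p ∈ Z j σ →
      u ∈ colourClass c j p := by
    rw [eventually_countable_forall]
    intro u
    rw [eventually_imp_distrib_left]
    intro hu
    exact hZB j σ {p | u ∈ colourClass c j p} (baireMeasurableSet_colourClass (hc j) u)
      (Eventually.of_forall fun p hp => (hp _ hu).2 rfl |>.1)
  have hext : ∀ᶠ p in residual X, ∀ N, p ∈ Z j σ →
      ∀ᶠ b in towerFilter k, ∃ α, BlockNear N α b ∧ p ∈ Z j (α :: σ) := by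
    rw [eventually_countable_forall]
    intro N
    -- The good set E may be wild, but this condition has the Baire property, so it passes from E to
    -- the hull.
    refine hZB j σ {p | ∀ᶠ b in towerFilter k, ∃ α, BlockNear N α b ∧ p ∈ Z j (α :: σ)} ?_ ?_
    · refine preservesBaire_towerFilter k (fun b => {p | ∃ α, BlockNear N α b ∧ p ∈ Z j (α :: σ)})
        fun b => IsOpen.baireMeasurableSet ?_
      have : {p | ∃ α, BlockNear N α b ∧ p ∈ Z j (α :: σ)} =
          ⋃ (α) (_ : BlockNear N α b), Z j (α :: σ) := by
        ext p; simp
      rw [this]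
      exact isOpen_iUnion fun α => isOpen_iUnion fun _ => hZo j _
    · filter_upwards [hEZ'] with p hp hpE
      filter_upwards [hΞ.eventually_exists_cons hpE N] with b hb
      obtain ⟨α, hα, hα'⟩ := hb
      exact ⟨α, hα, hp _ hα'⟩
  filter_upwards [hcol, hext] with p h1 h2 hpZ
  exact ⟨fun u hu => h1 u hu hpZ, fun N => h2 N hpZ⟩

end States

/-! ### Fusion -/

section Fusion

theorem exists_agree_subset {α : Type*} [TopologicalSpace α] {x : ℕ → α} {U : Set (ℕ → α)}
    (hU : U ∈ 𝓝 x) (Q : ℕ → ℕ → α → Prop)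
    (hQ : ∀ i, ∀ V ∈ 𝓝 (x i), ∃ m, ∀ M ≥ m, ∀ a, Q M i a → a ∈ V) :
    ∃ m, ∀ M ≥ m, ∀ y : ℕ → α, (∀ i < M, Q M i (y i)) → y ∈ U := by
  rw [nhds_pi, Filter.mem_pi] at hU
  obtain ⟨I, hI, t, ht, htU⟩ := hU
  choose m hm using fun i => hQ i (t i) (ht i)
  obtain ⟨B, hB⟩ := (hI.image fun i => max (i + 1) (m i)).bddAbove
  refine ⟨B, fun M hM y hy => htU fun i hi => ?_⟩
  have := hB (mem_image_of_mem _ hi)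
  exact hm i M (by omega) _ (hy i (by omega))

theorem exists_agree_subset_cantor {x : ℕ → Bool} {U : Set (ℕ → Bool)} (hU : U ∈ 𝓝 x) :
    ∃ m, ∀ M ≥ m, ∀ y : ℕ → Bool, (∀ i < M, y i = x i) → y ∈ U :=
  exists_agree_subset hU (fun _ i a => a = x i) fun _ _ hV =>
    ⟨0, fun _ _ _ ha => ha ▸ mem_of_mem_nhds hV⟩

theorem exists_box_subset {p : ℕ → ℕ → Bool} {U : Set (ℕ → ℕ → Bool)} (hU : U ∈ 𝓝 p) :
    ∃ m, ∀ M ≥ m, ∀ q : ℕ → ℕ → Bool, (∀ i < M, ∀ n < M, q i n = p i n) → q ∈ U :=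
  exists_agree_subset hU (fun M i a => ∀ n < M, a n = p i n) fun _ _ hV =>
    exists_agree_subset_cantor hV

theorem perfect_range_of_injective {φ : (ℕ → Bool) → (ℕ → Bool)} (hφ : Continuous φ)
    (hinj : Function.Injective φ) : Perfect (range φ) := by
  refine ⟨(isCompact_range hφ).isClosed, preperfect_iff_nhds.2 ?_⟩
  rintro _ ⟨x, rfl⟩ U hU
  obtain ⟨m, hm⟩ := exists_agree_subset_cantor (hφ.continuousAt hU)
  refine ⟨φ (Function.update x m (!x m)), ⟨hm m le_rfl _ fun i hi => ?_, mem_range_self _⟩, ?_⟩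
  · rw [Function.update_of_ne hi.ne]
  · intro h
    have := congrFun (hinj h) m
    simp at this

/-- Openness lets comeagre sets of parameters be pulled back to comeagre sets of whole trees of
points. -/
theorem isOpenMap_diagonal_eval {T : Type*} (w : ℕ → T) :
    IsOpenMap fun (g : ℕ → T → ℕ → Bool) (i : ℕ) => g i (w i) :=
  IsOpenMap.piMap (f := fun i (g : T → ℕ → Bool) => g (w i)) (fun i => isOpenMap_eval (w i))
    (Eventually.of_forall fun i => Function.surjective_eval (w i))

/-- Generic simultaneous choice of points with prescribed initial segments. -/
theorem exists_generic_choice {T W : Type*} [Finite T] [Finite W] (w : W → ℕ → T)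
    {Q : (ℕ → ℕ → Bool) → Prop} (hQ : ∀ᶠ p in residual (ℕ → ℕ → Bool), Q p)
    (tgt : ℕ → T → ℕ → Bool) (M : ℕ) :
    ∃ g : ℕ → T → ℕ → Bool, (∀ i < M, ∀ t, ∀ m < M, g i t m = tgt i t m) ∧
      ∀ v, Q fun i => g i (w v i) := by
  have hres : ∀ᶠ g in residual (ℕ → T → ℕ → Bool), ∀ v, Q fun i => g i (w v i) := by
    rw [eventually_all]
    intro v
    exact (tendsto_residual_of_isOpenMap (by fun_prop) (isOpenMap_diagonal_eval (w v))).eventually hQ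
  have hopen : IsOpen {g : ℕ → T → ℕ → Bool |
      ∀ (i : Fin M) (t : T) (m : Fin M), g i t m = tgt i t m} := by
    have : {g : ℕ → T → ℕ → Bool | ∀ (i : Fin M) (t : T) (m : Fin M), g i t m = tgt i t m} =
        ⋂ (i : Fin M) (t : T) (m : Fin M), (fun g => g i t m) ⁻¹' {tgt i t m} := by
      ext g; simp
    rw [this]
    refine isOpen_iInter_of_finite fun i => isOpen_iInter_of_finite fun t =>
      isOpen_iInter_of_finite fun m => (isOpen_discrete _).preimage (by fun_prop)
  obtain ⟨g, hg, hgQ⟩ := (dense_of_mem_residual hres).inter_open_nonempty _ hopen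
    ⟨tgt, fun _ _ _ => rfl⟩
  exact ⟨g, fun i hi t m hm => hg ⟨i, hi⟩ t ⟨m, hm⟩, hgQ⟩

variable {k : ℕ}

/-- A stage of the fusion: for each coordinate a finite tree of points, cut at level `M`, a bound
`N` for the supports used so far, a state for each choice of branches, and the latest block. -/
structure FusionStage (k : ℕ) where
  pt : ℕ → (ℕ → Bool) → (ℕ → Bool)
  M : ℕ
  N : ℕ
  state : (ℕ → ℕ → Bool) → State k
  block : FinSeq

/-- The invariants of the stages of the fusion. -/
structure FusionStage.Valid (Z : State k → Set (ℕ → ℕ → Bool)) (s : ℕ) (S : FusionStage k) :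
    Prop where
  le_M : s ≤ S.M
  pt_const : ∀ i, s ≤ i → ∀ x x', S.pt i x = S.pt i x'
  pt_congr : ∀ i x x', (∀ n < s, x n = x' n) → S.pt i x = S.pt i x'
  state_congr : ∀ θ θ', (∀ i < s, ∀ n < s, θ i n = θ' i n) → S.state θ = S.state θ'
  separates : ∀ i < s, ∀ x x', (∃ n < s, x n ≠ x' n) → ∃ m < S.M, S.pt i x m ≠ S.pt i x' m
  box : ∀ θ p, (∀ i < S.M, ∀ m < S.M, p i m = S.pt i (θ i) m) → p ∈ Z (S.state θ)

/-- The relation between consecutive stages of the fusion. -/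
structure FusionStage.Step (S S' : FusionStage k) : Prop where
  le_M : S.M ≤ S'.M
  pt_eq : ∀ i < S.M, ∀ m < S.M, ∀ x, S'.pt i x m = S.pt i x m
  suppFrom : SuppFrom S.N S'.block
  suppBelow : SuppBelow S'.N S'.block
  abs_le : ∀ n, |S'.block n| ≤ (k : ℤ)
  exists_abs_eq : ∃ n, |S'.block n| = (k : ℤ)
  le_N : S.N ≤ S'.N
  state_eq : ∀ θ, ∃ α, S'.state θ = α :: S.state θ ∧ BlockNear S.N α S'.block ∧
    ∀ x, SuppBelow S'.N (α x)

theorem exists_suppBelow_finite {ι : Type*} [Finite ι] (f : ι → FinSeq) (B : ℕ) :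
    ∃ N ≥ B, ∀ i, SuppBelow N (f i) := by
  choose N hN using fun i => exists_suppBelow (f i)
  obtain ⟨N', hN'⟩ := (finite_range N).bddAbove
  exact ⟨max B N', le_max_left _ _, fun i => (hN i).mono
    ((hN' (mem_range_self i)).trans (le_max_right _ _))⟩

variable {Z : State k → Set (ℕ → ℕ → Bool)}

/-- Move the points at the finitely many branches to generic positions, take one block b that suits
all choices of branches, then cut so far out that every box lies in its open set. -/
theorem FusionStage.exists_step (hk : 1 ≤ k) (hZo : ∀ σ, IsOpen (Z σ))
    (hZ : ∀ᶠ p in residual (ℕ → ℕ → Bool), ∀ σ, p ∈ Z σ → ∀ N,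
      ∀ᶠ b in towerFilter k, ∃ α, BlockNear N α b ∧ p ∈ Z (α :: σ))
    (s : ℕ) (S : FusionStage k) (hS : S.Valid Z s) :
    ∃ S' : FusionStage k, S'.Valid Z (s + 1) ∧ S.Step S' := by
  let T := Fin (s + 1) → Bool
  let W := Fin (s + 1) → T
  let r : (ℕ → Bool) → T := fun x n => x n
  let ext : T → ℕ → Bool := fun t n => if h : n < s + 1 then t ⟨n, h⟩ else false
  let w : W → ℕ → T := fun v i => if h : i < s + 1 then v ⟨i, h⟩ else fun _ => false
  let R : (ℕ → ℕ → Bool) → W := fun θ i => r (θ i)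
  have hext : ∀ x, ∀ n < s + 1, ext (r x) n = x n := fun x n hn => by
    simp only [ext, dif_pos hn, r]
  -- Below `S.M` the old point is kept. The next s + 1 places spell out the branch itself, so that
  -- distinct branches separate.
  obtain ⟨g, hg, hgQ⟩ := exists_generic_choice w hZ
    (fun i t m => if m < S.M then S.pt i (ext t) m else ext t (m - S.M)) (S.M + s + 1)
  have hg₁ : ∀ i < S.M, ∀ t, ∀ m < S.M, g i t m = S.pt i (ext t) m := fun i hi t m hm => by
    rw [hg i (by omega) t m (by omega), if_pos hm]
  have hg₂ : ∀ i < s + 1, ∀ x, ∀ n < s + 1, g i (r x) (S.M + n) = x n := fun i hi x n hn => by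
    rw [hg i (by omega) _ _ (by omega), if_neg (by omega), Nat.add_sub_cancel_left, hext x n hn]
  let pt' : ℕ → (ℕ → Bool) → (ℕ → Bool) := fun i x =>
    g i (if i < s + 1 then r x else fun _ => false)
  let br : W → ℕ → ℕ → Bool := fun v i => ext (w v i)
  have hwR : ∀ θ i, w (R θ) i = if i < s + 1 then r (θ i) else fun _ => false := by
    intro θ i
    by_cases h : i < s + 1
    · simp only [w, R, dif_pos h, if_pos h]
    · simp only [w, dif_neg h, if_neg h]
  have hstate : ∀ θ, S.state (br (R θ)) = S.state θ := fun θ =>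
    hS.state_congr _ _ fun i hi n hn => by
      have h : i < s + 1 := by omega
      simp only [br, hwR, if_pos h]
      exact hext _ _ (by omega)
  have hmem : ∀ v, (fun i => g i (w v i)) ∈ Z (S.state (br v)) := fun v =>
    hS.box _ _ fun i hi m hm => hg₁ i hi _ m hm
  have hpt : ∀ i < S.M, ∀ m < S.M, ∀ x, pt' i x m = S.pt i x m := by
    intro i hi m hm x
    simp only [pt', hg₁ i hi _ m hm]
    by_cases h : i < s
    · rw [if_pos (by omega)]
      exact congrFun (hS.pt_congr i _ _ fun n hn => hext _ _ (by omega)) m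
    · exact congrFun (hS.pt_const i (by omega) _ _) m
  have hF : ∀ᶠ b in towerFilter k, (∀ v, ∃ α, BlockNear S.N α b ∧
      (fun i => g i (w v i)) ∈ Z (α :: S.state (br v))) :=
    eventually_all.2 fun v => hgQ v _ (hmem v) S.N
  have hatt : ∀ᶠ b in towerFilter k, ∃ n, |b n| = (k : ℤ) := by
    obtain ⟨m, rfl⟩ : ∃ m, k = m + 1 := ⟨k - 1, by omega⟩
    exact eventually_exists_abs_towerFilter m
  have := neBot_towerFilter k
  obtain ⟨b, hb, hbk, hba, hbN⟩ := (hF.and ((eventually_abs_le_towerFilter k).and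
    (hatt.and (isTail_towerFilter k S.N)))).exists
  choose α hα hαZ using hb
  choose m hm using fun v => exists_box_subset ((hZo _).mem_nhds (hαZ v))
  obtain ⟨M₀, hM₀⟩ := (finite_range m).bddAbove
  obtain ⟨N₀, hN₀, hbN₀⟩ := exists_suppBelow_finite (fun _ : Unit => b) S.N
  obtain ⟨N', hN', hαN'⟩ := exists_suppBelow_finite (fun q : W × Letter k => α q.1 q.2) N₀
  have hS'M : S.M ≤ max (S.M + 1 + s) M₀ := by omega
  refine ⟨⟨pt', max (S.M + 1 + s) M₀, N', fun θ => α (R θ) :: S.state θ, b⟩, ?_, ?_⟩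
  · refine ⟨by simp only; omega, ?_, ?_, ?_, ?_, ?_⟩
    · intro i hi x x'
      have h : ¬ i < s + 1 := by omega
      simp only [pt', if_neg h]
    · intro i x x' h
      have : r x = r x' := by
        funext n
        exact h n n.isLt
      simp only [pt', this]
    · intro θ θ' h
      have h1 : R θ = R θ' := by
        funext i n
        exact h i i.isLt n n.isLt
      have h2 := hS.state_congr θ θ' fun i hi n hn => h i (by omega) n (by omega)
      simp only [h1, h2]
    · rintro i hi x x' ⟨n, hn, hne⟩
      refine ⟨S.M + n, by simp only; omega, ?_⟩
      simp only [pt', if_pos hi, hg₂ i hi _ n hn]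
      exact hne
    · intro θ p hp
      simp only at hp
      have := hM₀ (mem_range_self (R θ))
      change p ∈ Z (α (R θ) :: S.state θ)
      rw [← hstate]
      refine hm (R θ) (max (S.M + 1 + s) M₀) (by omega) p fun i hi n hn => ?_
      rw [hp i hi n hn]
      simp only [pt', hwR]
  · refine ⟨hS'M, hpt, hbN, (hbN₀ ()).mono hN', hbk, hba, by simp only; omega, fun θ => ?_⟩
    exact ⟨α (R θ), rfl, hα _, fun x => hαN' (R θ, x)⟩

/-- The initial stage of the fusion. -/
theorem FusionStage.exists_zero (hZo : ∀ σ, IsOpen (Z σ)) (hZ0 : (Z []).Nonempty) :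
    ∃ S : FusionStage k, S.Valid Z 0 ∧ ∀ θ, S.state θ = [] := by
  obtain ⟨p, hp⟩ := hZ0
  obtain ⟨m, hm⟩ := exists_box_subset ((hZo _).mem_nhds hp)
  exact ⟨⟨fun i _ => p i, m, 0, fun _ => [], 0⟩, ⟨Nat.zero_le _, fun _ _ _ _ => rfl,
    fun _ _ _ _ => rfl, fun _ _ _ => rfl, fun i hi => by omega, fun _ q hq => hm m le_rfl q hq⟩,
    fun _ => rfl⟩

/-- Perfect sets and a block sequence such that every choice of points from the perfect sets
follows a branch of open sets of states. -/
theorem exists_fusion (hk : 1 ≤ k) (hZo : ∀ σ, IsOpen (Z σ)) (hZ0 : (Z []).Nonempty)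
    (hZ : ∀ᶠ p in residual (ℕ → ℕ → Bool), ∀ σ, p ∈ Z σ → ∀ N,
      ∀ᶠ b in towerFilter k, ∃ α, BlockNear N α b ∧ p ∈ Z (α :: σ)) :
    ∃ (P : ℕ → Set (ℕ → Bool)) (b : ℕ → FinPM k) (N : ℕ → ℕ), Monotone N ∧
      (∀ i, Perfect (P i) ∧ (P i).Nonempty) ∧
      (∀ s, SuppFrom (N s) (b s).toFinsupp ∧ SuppBelow (N (s + 1)) (b s).toFinsupp) ∧
      ∀ p ∈ univ.pi P, ∃ (α : ℕ → Letter k → FinSeq) (σ : ℕ → State k), σ 0 = [] ∧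
        (∀ s, σ (s + 1) = α s :: σ s) ∧ (∀ s, p ∈ Z (σ s)) ∧
        (∀ s, BlockNear (N s) (α s) (b s).toFinsupp) ∧ ∀ s x, SuppBelow (N (s + 1)) (α s x) := by
  obtain ⟨S₀, hS₀, hS₀e⟩ := FusionStage.exists_zero hZo hZ0
  choose! f hf using FusionStage.exists_step hk hZo hZ
  let S : ℕ → FusionStage k := fun s => Nat.rec S₀ (fun s S => f s S) s
  have hS : ∀ s, (S s).Valid Z s := by
    intro s
    induction s with
    | zero => exact hS₀
    | succ s ih => exact (hf s _ ih).1
  have hstep : ∀ s, (S s).Step (S (s + 1)) := fun s => (hf s _ (hS s)).2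
  have hM : Monotone fun s => (S s).M := monotone_nat_of_le_succ fun s => (hstep s).le_M
  have hcoh : ∀ s t, s ≤ t → ∀ i < (S s).M, ∀ m < (S s).M, ∀ x,
      (S t).pt i x m = (S s).pt i x m := by
    intro s t hst i hi m hm x
    induction t, hst using Nat.le_induction with
    | base => rfl
    | succ t hst ih =>
      have := hM hst
      simp only at this
      rw [(hstep t).pt_eq i (by omega) m (by omega), ih]
  -- At stage `max i m + 1` both i and m are below the cut, since stage s has `s ≤ M`; the value is
  -- final from then on.
  let φ : ℕ → (ℕ → Bool) → (ℕ → Bool) := fun i x m => (S (max i m + 1)).pt i x m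
  have hφ : ∀ s, ∀ i < (S s).M, ∀ m < (S s).M, ∀ x, φ i x m = (S s).pt i x m := by
    intro s i hi m hm x
    have := (hS (max i m + 1)).le_M
    rw [← hcoh s _ (le_max_left s (max i m + 1)) i hi m hm,
      hcoh _ _ (le_max_right s (max i m + 1)) i (by omega) m (by omega)]
  have hφc : ∀ i, Continuous (φ i) := by
    intro i
    refine continuous_pi fun m => continuous_iff_continuousAt.2 fun x => ?_
    have hev : ∀ᶠ y in 𝓝 x, ∀ n : Fin (max i m + 1), y n = x n := by
      rw [eventually_all]
      intro n
      exact (continuous_apply (n : ℕ)).continuousAt.eventually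
        ((isOpen_discrete {x (n : ℕ)}).mem_nhds rfl)
    refine Tendsto.congr' ?_ tendsto_const_nhds
    filter_upwards [hev] with y hy
    exact congrFun ((hS _).pt_congr i _ _ fun n hn => (hy ⟨n, hn⟩).symm) m
  have hφi : ∀ i, Function.Injective (φ i) := by
    intro i x x' h
    by_contra hne
    obtain ⟨n, hn⟩ := Function.ne_iff.1 hne
    obtain ⟨m, hm, hm'⟩ := (hS (max i n + 1)).separates i (by omega) x x' ⟨n, by omega, hn⟩
    have := (hS (max i n + 1)).le_M
    rw [← hφ (max i n + 1) i (by omega) m hm, ← hφ (max i n + 1) i (by omega) m hm, h] at hm'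
    exact hm' rfl
  refine ⟨fun i => range (φ i), fun s => ⟨(S (s + 1)).block, (hstep s).abs_le,
    (hstep s).exists_abs_eq⟩, fun s => (S s).N, monotone_nat_of_le_succ fun s => (hstep s).le_N,
    fun i => ⟨perfect_range_of_injective (hφc i) (hφi i), range_nonempty _⟩,
    fun s => ⟨(hstep s).suppFrom, (hstep s).suppBelow⟩, fun p hp => ?_⟩
  choose θ hθ using fun i => hp i (mem_univ i)
  choose α hα hαb hαN using fun s => (hstep s).state_eq θ
  refine ⟨α, fun s => (S s).state θ, hS₀e θ, hα, fun s => ?_, hαb, hαN⟩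
  refine (hS s).box θ p fun i hi m hm => ?_
  rw [← hθ, hφ s i hi m hm]

end Fusion

/-! ### Sums along a branch, and the conclusion -/

section Sums

variable {k : ℕ}

theorem tetris_iterate_apply_eq_zero {a : FinSeq} {n : ℕ} (h : a n = 0) (j : ℕ) :
    (tetris^[j] a) n = 0 := by
  induction j with
  | zero => exact h
  | succ j ih =>
    rw [Function.iterate_succ_apply', tetris, Finsupp.mapRange_apply, ih]
    simp [tetrisValue]

theorem Letter.act_apply_eq_zero (x : Letter k) {a : FinSeq} {n : ℕ} (h : a n = 0) :
    x.act a n = 0 := by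
  rw [Letter.act, Finsupp.smul_apply, tetris_iterate_apply_eq_zero h, smul_zero]

/-- Sums of letters along a branch of states are sums of the states, near the corresponding
sums of the block sequence. -/
theorem near_sum_of_branch {b : ℕ → FinSeq} {N : ℕ → ℕ} (hN : Monotone N)
    (hb : ∀ s, SuppFrom (N s) (b s) ∧ SuppBelow (N (s + 1)) (b s))
    {α : ℕ → Letter k → FinSeq} {σ : ℕ → State k} (hσ0 : σ 0 = [])
    (hσ : ∀ s, σ (s + 1) = α s :: σ s) (hα : ∀ s, BlockNear (N s) (α s) (b s))
    (hαN : ∀ s x, SuppBelow (N (s + 1)) (α s x)) (m : ℕ) (ν : Fin m → ℕ) (hν : StrictMono ν)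
    (x : Fin m → Letter k) (s : ℕ) (hs : ∀ i, ν i < s) :
    Near (∑ i, α (ν i) (x i)) (∑ i, (x i).act (b (ν i))) ∧
      SuppBelow (N s) (∑ i, α (ν i) (x i)) ∧ SuppBelow (N s) (∑ i, (x i).act (b (ν i))) ∧
      ∃ f, (f, ∑ i, α (ν i) (x i)) ∈ stateSums (σ s) ∧ ((∃ i, (x i).2.val = 0) → f = true) := by
  have hmono : ∀ s t, s ≤ t → stateSums (σ s) ⊆ stateSums (σ t) := by
    intro s t hst
    induction t, hst using Nat.le_induction with
    | base => exact subset_rfl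
    | succ t _ ih =>
      rw [hσ]
      exact ih.trans subset_union_left
  induction m generalizing s with
  | zero =>
    refine ⟨by simpa using Near.refl 0, by simp [SuppBelow], by simp [SuppBelow], false, ?_, ?_⟩
    · refine hmono 0 s (Nat.zero_le s) ?_
      rw [hσ0]
      simp [stateSums]
    · rintro ⟨i, -⟩
      exact i.elim0
  | succ m ih =>
    obtain ⟨h1, h2, h3, f, hf, hfx⟩ := ih (ν ∘ Fin.castSucc) (hν.comp Fin.strictMono_castSucc)
      (x ∘ Fin.castSucc) (ν (Fin.last m)) fun i => hν (Fin.castSucc_lt_last i)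
    simp only [Function.comp_apply] at h1 h2 h3 hf hfx
    simp only [Fin.sum_univ_castSucc]
    set r := ν (Fin.last m)
    set y := x (Fin.last m) with hy
    have hrs : r + 1 ≤ s := hs (Fin.last m)
    have hNr : N r ≤ N s := hN (by omega)
    have hbr : SuppFrom (N r) (y.act (b r)) := fun n hn => y.act_apply_eq_zero ((hb r).1 n hn)
    have hbr' : SuppBelow (N s) (y.act (b r)) := fun n hn =>
      y.act_apply_eq_zero ((hb r).2 n ((hN hrs).trans hn))
    refine ⟨h1.add (hα r y).2 h2 h3 (hα r y).1 hbr, (h2.mono hNr).add ((hαN r y).mono (hN hrs)),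
      (h3.mono hNr).add hbr', f || decide (y.2.val = 0), ?_, ?_⟩
    · refine hmono _ _ hrs ?_
      rw [hσ]
      exact Or.inr (mem_iUnion.2 ⟨y, _, hf, rfl⟩)
    · rintro ⟨i, hi⟩
      induction i using Fin.lastCases with
      | last => simp [hy, hi]
      | cast i => simp [hfx ⟨i, hi⟩]

theorem exists_seq_dense_open_of_residual {X : Type*} [TopologicalSpace X] {Q : X → Prop}
    (hQ : ∀ᶠ p in residual X, Q p) :
    ∃ D : ℕ → Set X, (∀ s, IsOpen (D s)) ∧ (∀ s, Dense (D s)) ∧ ∀ p, (∀ s, p ∈ D s) → Q p := by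
  obtain ⟨S, hSo, hSd, hSc, hS⟩ := mem_residual_iff.1 hQ
  obtain ⟨D, hD⟩ := (hSc.insert univ).exists_eq_range (insert_nonempty _ _)
  have hmem : ∀ s, D s = univ ∨ D s ∈ S := fun s =>
    (hD ▸ mem_range_self s : D s ∈ insert univ S)
  refine ⟨D, fun s => ?_, fun s => ?_, fun p hp => hS ?_⟩
  · rcases hmem s with h | h
    · rw [h]; exact isOpen_univ
    · exact hSo _ h
  · rcases hmem s with h | h
    · rw [h]; exact dense_univ
    · exact hSd _ h
  · intro t ht
    obtain ⟨s, rfl⟩ : t ∈ range D := hD ▸ mem_insert_of_mem _ ht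
    exact hp s

theorem supNorm_sub_le_one {a b : FinSeq} (h : Near a b) : supNorm (b - a) ≤ 1 := by
  refine Finset.sup_le fun n _ => ?_
  have := abs_le.1 (h n)
  rw [Finsupp.sub_apply]
  omega

end Sums

theorem corollary4p6 (k : ℕ) (hk : 1 ≤ k) (n : ℕ)
    (c : FinPM k × (ℕ → ℕ → Bool) → Fin n)
    (hc : ∀ j : Fin n, SouslinMeasurable (c ⁻¹' {j})) :
    ∃ (B : BlockSeq k) (P : ℕ → Set (ℕ → Bool)) (j : Fin n),
      (∀ i, Perfect (P i) ∧ (P i).Nonempty) ∧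
      ∀ b ∈ B.generated, ∀ p ∈ Set.univ.pi P,
        ∃ b' : FinPM k, c (b', p) = j ∧ supNorm (b.toFinsupp - b'.toFinsupp) ≤ 1 := by
  obtain ⟨j, Z, hZo, hZ0, hZ⟩ := exists_open_state_system hk c hc
  obtain ⟨D, hDo, hDd, hD⟩ := exists_seq_dense_open_of_residual hZ
  -- Intersecting with `D σ.length` forces each p in the product of the perfect sets through every
  -- `D s`, because its s-th state has length s. So all such p are generic, and the colour statement
  -- holds for them.
  obtain ⟨P, b, N, hN, hP, hbN, hbranch⟩ := exists_fusion hk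
    (Z := fun σ => Z σ ∩ D σ.length) (fun σ => (hZo σ).inter (hDo _))
    ((hDd 0).inter_open_nonempty _ (hZo []) hZ0) (by
      filter_upwards [hZ, eventually_countable_forall.2 fun s =>
        residual_of_dense_open (hDo s) (hDd s)] with p hp hpD σ hpσ M
      filter_upwards [(hp σ hpσ.1).2 M] with b hb
      obtain ⟨α, hα, hpα⟩ := hb
      exact ⟨α, hα, hpα, hpD _⟩)
  refine ⟨⟨b, fun s t hst m hm l hl => ?_⟩, P, j, hP, ?_⟩
  · by_contra! hlm
    have hm' : m < N (s + 1) := by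
      by_contra! h
      exact Finsupp.mem_support_iff.1 hm ((hbN s).2 m h)
    have hl' : N t ≤ l := by
      by_contra! h
      exact Finsupp.mem_support_iff.1 hl ((hbN t).1 l h)
    have := hN (show s + 1 ≤ t from hst)
    omega
  rintro a ⟨m, ν, ε, i, hν, hε, hik, hi0, ha⟩ p hp
  obtain ⟨α, σ, hσ0, hσ, hpσ, hα, hαN⟩ := hbranch p hp
  have hlen : ∀ s, (σ s).length = s := by
    intro s
    induction s with
    | zero => simp [hσ0]
    | succ s ih => simp [hσ, ih]
  have hpD : ∀ s, p ∈ D s := fun s => by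
    have := (hpσ s).2
    rwa [hlen] at this
  have hunit : ∀ l, ∃ u : ℤˣ, (u : ℤ) = ε l := fun l =>
    (hε l).elim (fun h => ⟨1, by simp [h]⟩) fun h => ⟨-1, by simp [h]⟩
  choose u hu using hunit
  let x : Fin (m + 1) → Letter k := fun l => (u l, ⟨i l, hik l⟩)
  have hνlt : ∀ l, ν l < ν (Fin.last m) + 1 := fun l =>
    Nat.lt_succ_of_le (hν.monotone (Fin.le_last l))
  obtain ⟨hnear, -, -, f, hf, hfx⟩ := near_sum_of_branch (b := fun s => (b s).toFinsupp) hN hbN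
    hσ0 hσ hα hαN (m + 1) ν hν x _ hνlt
  rw [hfx hi0] at hf
  obtain ⟨h, hh, hhj⟩ := (hD p hpD _ (hpσ _).1).1 _ hf
  refine ⟨h, hhj, ?_⟩
  have hax : a.toFinsupp = ∑ l, (x l).act (b (ν l)).toFinsupp := by
    rw [ha]
    simp only [Letter.act, x, hu]
  rw [hax, hh]
  exact supNorm_sub_le_one hnear
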